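/- Let $k$ be a field and $e\ge 0$ an integer. For a $k$-algebra $R$, a lattice in $R((u))^2$ is a finitely generated projective $R[[u]]$-submodule that generates $R((u))^2$ over $R((u))$; put $\Lambda_0=R[[u]]^2$. Let $\mathrm{Gr}$ be the affine Grassmannian of $\mathrm{GL}_2$ over $k$, $\mathrm{Gr}(R)=\{\text{lattices in } R((u))^2\}$, and let $\widetilde{\mathrm{Gr}}$ be the $e$-fold convolution product, whose $R$-points are the sequences $(\Lambda_1,\dots,\Lambda_e)$ of lattices in $R((u))^2$, seen as chains of modifications $\Lambda_e\dashrightarrow\cdots\dashrightarrow\Lambda_1\dashrightarrow\Lambda_0$. The convolution morphism is $m:\widetilde{\mathrm{Gr}}\to\mathrm{Gr}$, $(\Lambda_i)_i\mapsto\Lambda_e$ (for $e=0$ it has value $\Lambda_0$). For lattices $\Lambda,\Lambda'\subset K((u))^2$ over a field $K\supset k$ and integers $a\ge b$, write $\mathrm{Inv}(\Lambda,\Lambda')=(a,b)$ if $\Lambda'$ has a $K[[u]]$-basis $(b_1,b_2)$ such that $(u^ab_1,u^bb_2)$ is a basis of $\Lambda$. Order these pairs by dominance: $(a,b)\le(a',b')$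 if $a\le a'$ and $a+b=a'+b'$. Let $\mathrm{Gr}_\lambda\subset|\mathrm{Gr}|$ be the set of points with $\mathrm{Inv}(\Lambda,\Lambda_0)=\lambda$, and let $\mathrm{Gr}_{(1,0)}\tilde\times\cdots\tilde\times\mathrm{Gr}_{(1,0)}\subset|\widetilde{\mathrm{Gr}}|$ ($e$ factors) be the set of points with $\mathrm{Inv}(\Lambda_i,\Lambda_{i-1})=(1,0)$ for $i=1,\dots,e$, with the topology induced by the Zariski topology. For $\lambda\le(e,0)$ let $X_\lambda$ be the intersection of $m^{-1}(\mathrm{Gr}_\lambda)$ with $\mathrm{Gr}_{(1,0)}\tilde\times\cdots\tilde\times\mathrm{Gr}_{(1,0)}$. Then $(X_\lambda)_{\lambda\le(e,0)}$ is a good stratification of $\mathrm{Gr}_{(1,0)}\tilde\times\cdots\tilde\times\mathrm{Gr}_{(1,0)}$: this space is the disjoint union of the $X_\lambda$, $\lambda\le(e,0)$, and for every $\lambda\le(e,0)$ $$\overline{X_\lambda}=\bigcup_{\lambda'\le\lambda}X_{\lambda'}.$$ -/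

import Mathlib

open CategoryTheory
open scoped PowerSeries LaurentSeries

universe u

noncomputable section

/-! ### Stratifications -/

/-- A stratification of a topological space `S` by a partially ordered set `I`: a decomposition
of `S` into pairwise disjoint subsets `X i` such that the closure of `X i` is contained in the
union of the `X j` with `j ≤ i`. -/
structure IsStratification {S I : Type*} [TopologicalSpace S] [PartialOrder I]
    (X : I → Set S) : Prop where
  iUnion_eq : ⋃ i, X i = Set.univ
  pairwise_disjoint : Pairwise fun i j => Disjoint (X i) (X j)
  closure_subset : ∀ i, closure (X i) ⊆ ⋃ j ≤ i, X j

/-- A good stratification: the closure of each stratum `X i` is equal to the union of the strata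
`X j` with `j ≤ i`. -/
structure IsGoodStratification {S I : Type*} [TopologicalSpace S] [PartialOrder I]
    (X : I → Set S) : Prop extends IsStratification X where
  closure_eq : ∀ i, closure (X i) = ⋃ j ≤ i, X j

/-! ### Dominant cocharacters of `GL_n` -/

/-- Dominant cocharacters of the diagonal torus of `GL_n`, i.e. the set `(ℤ^n)^+` of integral
vectors `a_1 ≥ ... ≥ a_n`. -/
@[ext]
structure DominantCocharacter (n : ℕ) where
  toFun : Fin n → ℤ
  antitone : Antitone toFun

namespace DominantCocharacter

variable {n : ℕ}

theorem eq_of_partial_sums {a b : DominantCocharacter n}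
    (h : ∀ i, ∑ j ∈ Finset.Iic i, a.toFun j = ∑ j ∈ Finset.Iic i, b.toFun j) : a = b := by
  have key : ∀ i : Fin n, a.toFun i = b.toFun i := by
    intro i
    induction i using WellFoundedLT.induction with
    | _ i ih =>
      have h1 := h i
      rw [← Finset.Iio_insert i, Finset.sum_insert (by simp), Finset.sum_insert (by simp),
        Finset.sum_congr rfl (fun j hj => ih j (Finset.mem_Iio.1 hj))] at h1
      exact add_right_cancel h1
  exact DominantCocharacter.ext (funext key)

/-- The dominance order: `a ≤ b` if `b - a` is a sum of positive coroots, i.e. all partial sums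
satisfy `a_1 + ... + a_i ≤ b_1 + ... + b_i`, with equality for the total sum. -/
instance : PartialOrder (DominantCocharacter n) where
  le a b := (∀ i, ∑ j ∈ Finset.Iic i, a.toFun j ≤ ∑ j ∈ Finset.Iic i, b.toFun j) ∧
    ∑ j, a.toFun j = ∑ j, b.toFun j
  le_refl _ := ⟨fun _ => le_rfl, rfl⟩
  le_trans _ _ _ h h' := ⟨fun i => (h.1 i).trans (h'.1 i), h.2.trans h'.2⟩
  le_antisymm _ _ h h' := eq_of_partial_sums fun i => le_antisymm (h.1 i) (h'.1 i)

/-- The sum `|μ| = μ_1 + ... + μ_e` of a family of dominant cocharacters. -/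
def total {e : ℕ} (μ : Fin e → DominantCocharacter n) : DominantCocharacter n where
  toFun j := ∑ i, (μ i).toFun j
  antitone _ _ h := Finset.sum_le_sum fun i _ => (μ i).antitone h

end DominantCocharacter

/-! ### Laurent series and base change -/

/-- The ring homomorphism `R((u)) → S((u))` obtained by applying `f : R → S` to all
coefficients. -/
def laurentMap {R S : Type*} [CommRing R] [CommRing S] (f : R →+* S) : R⸨X⸩ →+* S⸨X⸩ where
  toFun x := HahnSeries.map x f
  map_zero' := by ext; simp
  map_one' := by
    ext i
    by_cases h : i = 0 <;> simp [h, HahnSeries.coeff_one]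
  map_add' x y := by ext; simp
  map_mul' x y := by
    ext i
    rw [HahnSeries.map_coeff, HahnSeries.coeff_mul, HahnSeries.coeff_mul, map_sum]
    symm
    have hx := HahnSeries.support_map_subset x (f : ZeroHom R S)
    have hy := HahnSeries.support_map_subset y (f : ZeroHom R S)
    simp only [map_mul, HahnSeries.map_coeff]
    refine Finset.sum_subset ?_ ?_
    · intro p hp
      rw [Finset.mem_antidiagonal] at hp ⊢
      exact ⟨hx hp.1, hy hp.2.1, hp.2.2⟩
    · intro p hp hp'
      rw [Finset.mem_antidiagonal] at hp hp'
      by_contra hne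
      refine hp' ⟨?_, ?_, hp.2.2⟩
      · intro h0
        exact hne (by
          have : f (x.coeff p.1) = 0 := h0
          rw [this, zero_mul])
      · intro h0
        exact hne (by
          have : f (y.coeff p.2) = 0 := h0
          rw [this, mul_zero])

section Lattices

variable {n : ℕ} {R S T : Type*} [CommRing R] [CommRing S] [CommRing T]

theorem laurentMap_algebraMap (f : R →+* S) (a : R⟦X⟧) :
    laurentMap f (algebraMap R⟦X⟧ R⸨X⸩ a) = algebraMap S⟦X⟧ S⸨X⸩ (PowerSeries.map f a) := by
  ext i
  change f ((HahnSeries.ofPowerSeries ℤ R a).coeff i) =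
    (HahnSeries.ofPowerSeries ℤ S (PowerSeries.map f a)).coeff i
  rw [PowerSeries.coeff_coe, PowerSeries.coeff_coe]
  split_ifs <;> simp

theorem laurentMap_id (x : R⸨X⸩) : laurentMap (RingHom.id R) x = x := by
  ext i; rfl

theorem laurentMap_comp (f : R →+* S) (g : S →+* T) (x : R⸨X⸩) :
    laurentMap (g.comp f) x = laurentMap g (laurentMap f x) := by
  ext i; rfl

/-- The map `R((u))^n → S((u))^n` obtained by applying `f : R → S` to all coefficients. -/
def laurentVecMap (f : R →+* S) (v : Fin n → R⸨X⸩) : Fin n → S⸨X⸩ := fun i => laurentMap f (v i)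

/-! ### Lattices -/

variable (n R) in
/-- An `R`-family of lattices in `R((u))^n`: an `R[[u]]`-submodule which is finitely generated
and projective (equivalently, locally free of finite rank) and which generates `R((u))^n` over
`R((u))`. -/
@[ext]
structure LaurentLattice where
  carrier : Submodule R⟦X⟧ (Fin n → R⸨X⸩)
  finite : Module.Finite R⟦X⟧ carrier
  projective : Module.Projective R⟦X⟧ carrier
  span_eq_top : Submodule.span R⸨X⸩ (carrier : Set (Fin n → R⸨X⸩)) = ⊤

/-- A finite dual basis for a submodule `N` of `R((u))^n`, with respect to the dot product. -/
def HasDualBasis (N : Submodule R⟦X⟧ (Fin n → R⸨X⸩)) : Prop :=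
  ∃ (m : ℕ) (x φ : Fin m → Fin n → R⸨X⸩), (∀ j, x j ∈ N) ∧
    (∀ j, ∀ v ∈ N, ∃ a : R⟦X⟧, φ j ⬝ᵥ v = algebraMap R⟦X⟧ R⸨X⸩ a) ∧
    ∀ v, ∑ j, (φ j ⬝ᵥ v) • x j = v

theorem algebraMap_laurent_injective :
    Function.Injective (algebraMap R⟦X⟧ R⸨X⸩) :=
  HahnSeries.ofPowerSeries_injective

theorem X_pow_mul_single_neg (N : ℕ) :
    algebraMap R⟦X⟧ R⸨X⸩ (PowerSeries.X ^ N) * HahnSeries.single (-(N : ℤ)) 1 = 1 := by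
  have : algebraMap R⟦X⟧ R⸨X⸩ (PowerSeries.X ^ N) = HahnSeries.single (N : ℤ) 1 := by
    change HahnSeries.ofPowerSeries ℤ R _ = _
    simp
  rw [this, HahnSeries.single_mul_single]
  simp

theorem exists_X_pow_mul (x : R⸨X⸩) :
    ∃ (N : ℕ) (a : R⟦X⟧), algebraMap R⟦X⟧ R⸨X⸩ (PowerSeries.X ^ N) * x =
      algebraMap R⟦X⟧ R⸨X⸩ a := by
  obtain ⟨⟨a, ⟨_, N, rfl⟩⟩, h⟩ :=
    IsLocalization.surj (Submonoid.powers (PowerSeries.X : R⟦X⟧)) x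
  exact ⟨N, a, by rw [mul_comm]; exact h⟩

theorem exists_X_pow_smul_mem (N : Submodule R⟦X⟧ (Fin n → R⸨X⸩))
    (hN : Submodule.span R⸨X⸩ (N : Set (Fin n → R⸨X⸩)) = ⊤) (v : Fin n → R⸨X⸩) :
    ∃ k : ℕ, (PowerSeries.X ^ k : R⟦X⟧) • v ∈ N := by
  have hv : v ∈ Submodule.span R⸨X⸩ (N : Set (Fin n → R⸨X⸩)) := hN ▸ Submodule.mem_top
  induction hv using Submodule.span_induction with
  | mem x hx => exact ⟨0, by simpa using hx⟩
  | zero => exact ⟨0, by simp⟩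
  | add x y _ _ hx hy =>
    obtain ⟨k, hk⟩ := hx
    obtain ⟨l, hl⟩ := hy
    refine ⟨k + l, ?_⟩
    rw [smul_add]
    refine N.add_mem ?_ ?_
    · rw [pow_add, mul_comm, mul_smul]; exact N.smul_mem _ hk
    · rw [pow_add, mul_smul]; exact N.smul_mem _ hl
  | smul a x _ hx =>
    obtain ⟨k, hk⟩ := hx
    obtain ⟨l, b, hb⟩ := exists_X_pow_mul a
    refine ⟨l + k, ?_⟩
    have : (PowerSeries.X ^ (l + k) : R⟦X⟧) • a • x = b • (PowerSeries.X ^ k : R⟦X⟧) • x := by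
      simp only [← algebraMap_smul R⸨X⸩ (_ : R⟦X⟧) (_ : Fin n → R⸨X⸩), smul_smul]
      rw [← hb, pow_add, map_mul]
      ring_nf
    rw [this]
    exact N.smul_mem _ hk

theorem LaurentLattice.hasDualBasis (L : LaurentLattice n R) : HasDualBasis L.carrier := by
  have := L.finite
  have := L.projective
  obtain ⟨m, f, g, -, -, hfg⟩ := Module.Finite.exists_comp_eq_id_of_projective R⟦X⟧ L.carrier
  have key : ∀ h : L.carrier →ₗ[R⟦X⟧] R⟦X⟧, ∃ φ : Fin n → R⸨X⸩,
      ∀ v : L.carrier, φ ⬝ᵥ (v : Fin n → R⸨X⸩) = algebraMap R⟦X⟧ R⸨X⸩ (h v) := by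
    intro h
    choose N hN using fun i : Fin n =>
      exists_X_pow_smul_mem L.carrier L.span_eq_top (Pi.single i (1 : R⸨X⸩))
    refine ⟨fun i => HahnSeries.single (-(N i : ℤ)) 1 * algebraMap R⟦X⟧ R⸨X⸩ (h ⟨_, hN i⟩), ?_⟩
    intro v
    choose M a ha using fun i : Fin n => exists_X_pow_mul ((v : Fin n → R⸨X⸩) i)
    have hv : (∏ i, (PowerSeries.X ^ (M i + N i) : R⟦X⟧)) • v =
        ∑ i, ((∏ j ∈ Finset.univ.erase i, (PowerSeries.X ^ (M j + N j) : R⟦X⟧)) * a i) •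
          (⟨_, hN i⟩ : L.carrier) := by
      apply Subtype.ext
      ext1 l
      rw [Submodule.coe_sum, Finset.sum_apply, Finset.sum_eq_single l]
      · simp only [Submodule.coe_smul, Pi.smul_apply, Pi.single_eq_same,
          ← algebraMap_smul R⸨X⸩ (_ : R⟦X⟧) (_ : Fin n → R⸨X⸩), smul_eq_mul, mul_one]
        simp only [Algebra.smul_def, map_mul]
        rw [← Finset.mul_prod_erase _ _ (Finset.mem_univ l), map_mul, ← ha, pow_add, map_mul]
        ring
      · intro i _ hi
        simp [Pi.single_eq_of_ne' hi]
      · simp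
    have hv' := congrArg (fun w => algebraMap R⟦X⟧ R⸨X⸩ (h w)) hv
    simp only [map_sum, map_smul, smul_eq_mul, map_mul] at hv'
    have hu : IsUnit (algebraMap R⟦X⟧ R⸨X⸩ (∏ i, (PowerSeries.X ^ (M i + N i) : R⟦X⟧))) := by
      rw [map_prod]
      exact IsUnit.prod_univ_iff.2 fun i => IsUnit.of_mul_eq_one _ (X_pow_mul_single_neg _)
    refine hu.mul_left_cancel ?_
    rw [hv', dotProduct, Finset.mul_sum]
    refine Finset.sum_congr rfl fun i _ => ?_
    rw [← ha, ← Finset.mul_prod_erase _ _ (Finset.mem_univ i), map_mul, pow_add, map_mul]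
    linear_combination (algebraMap R⟦X⟧ R⸨X⸩ (PowerSeries.X ^ M i) *
      algebraMap R⟦X⟧ R⸨X⸩ (∏ j ∈ Finset.univ.erase i, (PowerSeries.X ^ (M j + N j) : R⟦X⟧)) *
      algebraMap R⟦X⟧ R⸨X⸩ (h ⟨_, hN i⟩) * (v : Fin n → R⸨X⸩) i) * X_pow_mul_single_neg (R := R) (N i)
  choose φ hφ using fun j : Fin m => key ((LinearMap.proj j).comp g)
  refine ⟨m, fun j => f (Pi.single j 1), φ, fun j => (f (Pi.single j 1)).2,
    fun j v hv => ⟨_, hφ j ⟨v, hv⟩⟩, fun v => ?_⟩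
  let A : (Fin n → R⸨X⸩) →ₗ[R⸨X⸩] (Fin n → R⸨X⸩) :=
    ∑ j, (LinearMap.toSpanSingleton R⸨X⸩ _ (f (Pi.single j 1) : Fin n → R⸨X⸩)).comp
      (dotProductBilin R⸨X⸩ R⸨X⸩ (φ j))
  have hA : A = LinearMap.id := by
    refine LinearMap.ext_on L.span_eq_top ?_
    intro w hw
    have h1 : f (g ⟨w, hw⟩) = ⟨w, hw⟩ := LinearMap.congr_fun hfg _
    have h2 : g ⟨w, hw⟩ = ∑ j, (g ⟨w, hw⟩ j) • (Pi.single j 1 : Fin m → R⟦X⟧) := by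
      exact pi_eq_sum_univ' _
    rw [h2, map_sum] at h1
    have h3 := congrArg Subtype.val h1
    simp only [map_smul, Submodule.coe_sum, Submodule.coe_smul] at h3
    simp only [A, LinearMap.sum_apply, LinearMap.comp_apply, LinearMap.toSpanSingleton_apply,
      dotProductBilin_apply_apply, LinearMap.id_apply]
    refine Eq.trans (Finset.sum_congr rfl fun j _ => ?_) h3
    have := hφ j ⟨w, hw⟩
    rw [this, algebraMap_smul]
    rfl
  have := LinearMap.congr_fun hA v
  simpa [A] using this

/-- A submodule of `R((u))^n` with a finite dual basis is a lattice. -/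
def LaurentLattice.ofDualBasis (N : Submodule R⟦X⟧ (Fin n → R⸨X⸩)) (h : HasDualBasis N) :
    LaurentLattice n R where
  carrier := N
  finite := by
    classical
    obtain ⟨m, x, φ, hx, hφ, hv⟩ := h
    refine ⟨(Submodule.fg_top N).2 ?_⟩
    refine ⟨Finset.univ.image x, le_antisymm ?_ ?_⟩
    · rw [Submodule.span_le]
      intro y hy
      simp only [Finset.coe_image, Finset.coe_univ, Set.image_univ, Set.mem_range] at hy
      obtain ⟨j, rfl⟩ := hy
      exact hx j
    · intro v hvN
      rw [← hv v]
      refine Submodule.sum_mem _ fun j _ => ?_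
      obtain ⟨a, ha⟩ := hφ j v hvN
      rw [ha, algebraMap_smul]
      exact Submodule.smul_mem _ _ (Submodule.subset_span (by simp))
  projective := by
    obtain ⟨m, x, φ, hx, hφ, hv⟩ := h
    choose a ha using fun (v : N) (j : Fin m) => hφ j v.1 v.2
    let i : N →ₗ[R⟦X⟧] (Fin m → R⟦X⟧) :=
      { toFun := a
        map_add' := fun v w => funext fun j => algebraMap_laurent_injective (by
          rw [← ha, Pi.add_apply, map_add, ← ha, ← ha, Submodule.coe_add, dotProduct_add])
        map_smul' := fun c v => funext fun j => algebraMap_laurent_injective (by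
          rw [← ha, RingHom.id_apply, Pi.smul_apply, smul_eq_mul, map_mul, ← ha, Submodule.coe_smul,
            ← algebraMap_smul R⸨X⸩ c, dotProduct_smul, smul_eq_mul]) }
    let s : (Fin m → R⟦X⟧) →ₗ[R⟦X⟧] N :=
      Fintype.linearCombination R⟦X⟧ (fun j => (⟨x j, hx j⟩ : N))
    refine Module.Projective.of_split i s (LinearMap.ext fun v => Subtype.ext ?_)
    have h1 : ((s (i v) : N) : Fin n → R⸨X⸩) = ∑ j, a v j • x j := by
      simp [s, i, Fintype.linearCombination_apply]
    change ((s (i v) : N) : Fin n → R⸨X⸩) = v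
    rw [h1]
    refine Eq.trans (Finset.sum_congr rfl fun j _ => ?_) (hv v)
    rw [ha, algebraMap_smul]
  span_eq_top := by
    obtain ⟨m, x, φ, hx, hφ, hv⟩ := h
    rw [eq_top_iff]
    intro v _
    rw [← hv v]
    exact Submodule.sum_mem _ fun j _ => Submodule.smul_mem _ _ (Submodule.subset_span (hx j))

theorem laurentVecMap_add (f : R →+* S) (v w : Fin n → R⸨X⸩) :
    laurentVecMap f (v + w) = laurentVecMap f v + laurentVecMap f w :=
  funext fun _ => map_add _ _ _

theorem laurentVecMap_smul (f : R →+* S) (a : R⸨X⸩) (v : Fin n → R⸨X⸩) :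
    laurentVecMap f (a • v) = laurentMap f a • laurentVecMap f v :=
  funext fun _ => map_mul _ _ _

theorem laurentVecMap_smul' (f : R →+* S) (a : R⟦X⟧) (v : Fin n → R⸨X⸩) :
    laurentVecMap f (a • v) = PowerSeries.map f a • laurentVecMap f v := by
  rw [← algebraMap_smul R⸨X⸩ a v, laurentVecMap_smul, laurentMap_algebraMap, algebraMap_smul]

theorem laurentVecMap_dotProduct (f : R →+* S) (v w : Fin n → R⸨X⸩) :
    laurentVecMap f v ⬝ᵥ laurentVecMap f w = laurentMap f (v ⬝ᵥ w) := by
  simp [dotProduct, laurentVecMap]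

theorem laurentVecMap_sum (f : R →+* S) {ι : Type*} (s : Finset ι) (v : ι → Fin n → R⸨X⸩) :
    laurentVecMap f (∑ j ∈ s, v j) = ∑ j ∈ s, laurentVecMap f (v j) := by
  ext1 i
  simp [laurentVecMap, Finset.sum_apply]

theorem laurentVecMap_single (f : R →+* S) (i : Fin n) :
    laurentVecMap f (Pi.single i (1 : R⸨X⸩)) = Pi.single i 1 := by
  ext1 j
  by_cases h : j = i
  · subst h; simp [laurentVecMap]
  · simp [laurentVecMap, Pi.single_eq_of_ne h]

/-- The `S[[u]]`-submodule of `S((u))^n` generated by the image of `N`. -/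
def laurentSpanMap (f : R →+* S) (N : Submodule R⟦X⟧ (Fin n → R⸨X⸩)) :
    Submodule S⟦X⟧ (Fin n → S⸨X⸩) :=
  Submodule.span S⟦X⟧ (laurentVecMap f '' (N : Set (Fin n → R⸨X⸩)))

theorem HasDualBasis.map (f : R →+* S) {N : Submodule R⟦X⟧ (Fin n → R⸨X⸩)}
    (h : HasDualBasis N) : HasDualBasis (laurentSpanMap f N) := by
  obtain ⟨m, x, φ, hx, hφ, hv⟩ := h
  refine ⟨m, fun j => laurentVecMap f (x j), fun j => laurentVecMap f (φ j),
    fun j => Submodule.subset_span ⟨x j, hx j, rfl⟩, fun j v hvN => ?_, fun v => ?_⟩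
  · induction hvN using Submodule.span_induction with
    | mem v hv =>
      obtain ⟨w, hw, rfl⟩ := hv
      obtain ⟨a, ha⟩ := hφ j w hw
      exact ⟨PowerSeries.map f a, by rw [laurentVecMap_dotProduct, ha, laurentMap_algebraMap]⟩
    | zero => exact ⟨0, by simp⟩
    | add v w _ _ hv hw =>
      obtain ⟨a, ha⟩ := hv
      obtain ⟨b, hb⟩ := hw
      exact ⟨a + b, by rw [dotProduct_add, ha, hb, map_add]⟩
    | smul c v _ hv =>
      obtain ⟨a, ha⟩ := hv
      exact ⟨c * a, by
        rw [← algebraMap_smul S⸨X⸩ c, dotProduct_smul, ha, smul_eq_mul, map_mul]⟩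
  · let A : (Fin n → S⸨X⸩) →ₗ[S⸨X⸩] (Fin n → S⸨X⸩) :=
      ∑ j, (LinearMap.toSpanSingleton S⸨X⸩ _ (laurentVecMap f (x j))).comp
        (dotProductBilin S⸨X⸩ S⸨X⸩ (laurentVecMap f (φ j)))
    have hA : A = LinearMap.id := by
      refine (Pi.basisFun S⸨X⸩ (Fin n)).ext fun i => ?_
      have h1 := congrArg (laurentVecMap f) (hv (Pi.single i 1))
      simp only [laurentVecMap_sum, laurentVecMap_smul, ← laurentVecMap_dotProduct,
        laurentVecMap_single] at h1
      simpa [A] using h1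
    have := LinearMap.congr_fun hA v
    simpa [A] using this

/-- Base change of a lattice along `f : R → S`: the `S[[u]]`-submodule of `S((u))^n` generated by
the image of `L`, that is, the image of `L ⊗ S[[u]]` in `S((u))^n`. -/
def LaurentLattice.map (f : R →+* S) (L : LaurentLattice n R) : LaurentLattice n S :=
  LaurentLattice.ofDualBasis (laurentSpanMap f L.carrier) (L.hasDualBasis.map f)

theorem LaurentLattice.map_id (L : LaurentLattice n R) : L.map (RingHom.id R) = L := by
  refine LaurentLattice.ext ?_
  change Submodule.span R⟦X⟧ (laurentVecMap (RingHom.id R) '' (L.carrier : Set _)) = L.carrier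
  have : (laurentVecMap (RingHom.id R) : (Fin n → R⸨X⸩) → _) = id :=
    funext fun v => funext fun i => laurentMap_id _
  rw [this, Set.image_id, Submodule.span_eq]

theorem LaurentLattice.map_comp (f : R →+* S) (g : S →+* T) (L : LaurentLattice n R) :
    L.map (g.comp f) = (L.map f).map g := by
  refine LaurentLattice.ext ?_
  change Submodule.span T⟦X⟧ (laurentVecMap (g.comp f) '' (L.carrier : Set _)) =
    Submodule.span T⟦X⟧ (laurentVecMap g ''
      (laurentSpanMap f L.carrier : Set (Fin n → S⸨X⸩)))
  refine le_antisymm (Submodule.span_le.2 ?_) (Submodule.span_le.2 ?_)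
  · rintro _ ⟨v, hv, rfl⟩
    have h1 : laurentVecMap f v ∈ laurentSpanMap f L.carrier := Submodule.subset_span ⟨v, hv, rfl⟩
    have h2 : laurentVecMap (g.comp f) v = laurentVecMap g (laurentVecMap f v) :=
      funext fun i => laurentMap_comp f g (v i)
    rw [h2]
    exact Submodule.subset_span ⟨_, h1, rfl⟩
  · rintro _ ⟨w, hw, rfl⟩
    have hw' : w ∈ Submodule.span S⟦X⟧
      (laurentVecMap f '' (L.carrier : Set (Fin n → R⸨X⸩))) := hw
    rw [SetLike.mem_coe]
    clear hw
    induction hw' using Submodule.span_induction with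
    | mem w hw =>
      obtain ⟨v, hv, rfl⟩ := hw
      have h2 : laurentVecMap g (laurentVecMap f v) = laurentVecMap (g.comp f) v :=
        funext fun i => (laurentMap_comp f g (v i)).symm
      rw [h2]
      exact Submodule.subset_span ⟨v, hv, rfl⟩
    | zero =>
      have : laurentVecMap g (0 : Fin n → S⸨X⸩) = 0 := funext fun _ => map_zero _
      rw [this]
      exact Submodule.zero_mem _
    | add v w _ _ hv hw => rw [laurentVecMap_add]; exact Submodule.add_mem _ hv hw
    | smul c v _ hv => rw [laurentVecMap_smul']; exact Submodule.smul_mem _ _ hv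

variable (n R) in
/-- The standard lattice `R[[u]]^n` in `R((u))^n`, generated by the standard basis vectors. -/
def LaurentLattice.std : LaurentLattice n R :=
  LaurentLattice.ofDualBasis
    (Submodule.span R⟦X⟧ (Set.range fun i : Fin n => (Pi.single i 1 : Fin n → R⸨X⸩))) <| by
      refine ⟨n, fun i => Pi.single i 1, fun i => Pi.single i 1,
        fun i => Submodule.subset_span ⟨i, rfl⟩, fun j v hv => ?_, fun v => ?_⟩
      · rw [single_dotProduct, one_mul]
        induction hv using Submodule.span_induction with
        | mem v hv =>
          obtain ⟨i, rfl⟩ := hv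
          by_cases h : j = i
          · subst h; exact ⟨1, by simp⟩
          · exact ⟨0, by simp [Pi.single_eq_of_ne h]⟩
        | zero => exact ⟨0, by simp⟩
        | add v w _ _ hv hw =>
          obtain ⟨a, ha⟩ := hv
          obtain ⟨b, hb⟩ := hw
          exact ⟨a + b, by rw [Pi.add_apply, ha, hb, map_add]⟩
        | smul c v _ hv =>
          obtain ⟨a, ha⟩ := hv
          exact ⟨c * a, by
            rw [← algebraMap_smul R⸨X⸩ c, Pi.smul_apply, ha, smul_eq_mul, map_mul]⟩
      · simp only [single_dotProduct, one_mul]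
        exact (pi_eq_sum_univ' v).symm

theorem LaurentLattice.map_std (f : R →+* S) :
    (LaurentLattice.std n R).map f = LaurentLattice.std n S := by
  refine LaurentLattice.ext ?_
  change Submodule.span S⟦X⟧ (laurentVecMap f '' (Submodule.span R⟦X⟧
      (Set.range fun i : Fin n => (Pi.single i 1 : Fin n → R⸨X⸩)) : Set (Fin n → R⸨X⸩))) =
    Submodule.span S⟦X⟧ (Set.range fun i : Fin n => (Pi.single i 1 : Fin n → S⸨X⸩))
  refine le_antisymm (Submodule.span_le.2 ?_) (Submodule.span_le.2 ?_)
  · rintro _ ⟨w, hw, rfl⟩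
    change w ∈ Submodule.span R⟦X⟧ _ at hw
    rw [SetLike.mem_coe]
    induction hw using Submodule.span_induction with
    | mem w hw =>
      obtain ⟨i, rfl⟩ := hw
      exact Submodule.subset_span ⟨i, (laurentVecMap_single f i).symm⟩
    | zero =>
      have : laurentVecMap f (0 : Fin n → R⸨X⸩) = 0 := funext fun _ => map_zero _
      rw [this]
      exact Submodule.zero_mem _
    | add v w _ _ hv hw => rw [laurentVecMap_add]; exact Submodule.add_mem _ hv hw
    | smul c v _ hv => rw [laurentVecMap_smul']; exact Submodule.smul_mem _ _ hv
  · rintro _ ⟨i, rfl⟩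
    exact Submodule.subset_span ⟨Pi.single i 1, Submodule.subset_span ⟨i, rfl⟩,
      laurentVecMap_single f i⟩

end Lattices

/-- The relative position `Inv(L, L') = a` of two lattices over a field `K`: there is a basis
`(b_1, ..., b_n)` of `L'` over `K[[u]]` such that `L` is generated by `u^{a_1} b_1, ...,
u^{a_n} b_n` (which are then a basis of `L`). -/
def LaurentLattice.HasRelPos {n : ℕ} {K : Type*} [Field K] (L L' : LaurentLattice n K)
    (a : DominantCocharacter n) : Prop :=
  ∃ b : Module.Basis (Fin n) K⟦X⟧ L'.carrier,
    L.carrier = Submodule.span K⟦X⟧ (Set.range fun i =>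
      (HahnSeries.single (a.toFun i) (1 : K) : K⸨X⸩) • (b i : Fin n → K⸨X⸩))

/-! ### The topological space of a functor of points -/

section FunctorSpace

variable {k : Type u} [Field k]

/-- A field-valued point of a functor `F` on `k`-algebras: a field extension `K` of `k` together
with an element of `F(K)`. -/
structure FieldPoint (F : CommAlgCat.{u} k ⥤ Type u) where
  K : Type u
  [field : Field K]
  [algebra : Algebra k K]
  pt : F.obj (CommAlgCat.of k K)

attribute [instance] FieldPoint.field FieldPoint.algebra

/-- The set of points of (the geometric realization of) a functor `F` on `k`-algebras:
field-valued points, modulo the equivalence relation generated by identifying `x ∈ F(K)` with its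
image in `F(L)` for every homomorphism of `k`-algebras `K → L`. When `F` is the functor of points
of a `k`-scheme, this is the set of points of the scheme. -/
def FunctorSpace (F : CommAlgCat.{u} k ⥤ Type u) : Type (u + 1) :=
  Quot fun x y : FieldPoint F => ∃ f : x.K →ₐ[k] y.K, F.map (CommAlgCat.ofHom f) x.pt = y.pt

/-- The point of the space of `F` defined by a field-valued point. -/
def FieldPoint.toSpace {F : CommAlgCat.{u} k ⥤ Type u} (x : FieldPoint F) : FunctorSpace F :=
  Quot.mk _ x

/-- The map `Spec R → |F|` defined by an element `x ∈ F(R)`: it sends a prime `p` to the image of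
`x` in `F(κ(p))`, where `κ(p)` is the residue field. -/
def FunctorSpace.specMap (F : CommAlgCat.{u} k ⥤ Type u) {R : CommAlgCat.{u} k} (x : F.obj R)
    (p : PrimeSpectrum R) : FunctorSpace F :=
  FieldPoint.toSpace
    { K := p.asIdeal.ResidueField
      pt := F.map (CommAlgCat.ofHom (IsScalarTower.toAlgHom k R p.asIdeal.ResidueField)) x }

/-- The topology of the geometric realization `|F|`: the finest topology for which the maps
`Spec R → |F|` are continuous, for all `k`-algebras `R` and all `x ∈ F(R)`. When `F` is the functor
of points of a `k`-scheme, this is the Zariski topology of the scheme. -/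
instance (F : CommAlgCat.{u} k ⥤ Type u) : TopologicalSpace (FunctorSpace F) where
  IsOpen U := ∀ (R : CommAlgCat.{u} k) (x : F.obj R), IsOpen (FunctorSpace.specMap F x ⁻¹' U)
  isOpen_univ _ _ := isOpen_univ
  isOpen_inter _ _ h h' R x := (h R x).inter (h' R x)
  isOpen_sUnion _ h R x := by
    rw [Set.preimage_sUnion]
    exact isOpen_biUnion fun U hU => h U hU R x

/-- The map `|F| → |G|` induced by a morphism of functors `F → G`. -/
def FunctorSpace.map {F G : CommAlgCat.{u} k ⥤ Type u} (η : F ⟶ G) :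
    FunctorSpace F → FunctorSpace G :=
  Quot.map (fun x => { K := x.K, pt := η.app _ x.pt }) <| by
    rintro x y ⟨f, hf⟩
    refine ⟨f, ?_⟩
    change G.map (CommAlgCat.ofHom f) (η.app _ x.pt) = η.app _ y.pt
    rw [← hf]
    exact (NatTrans.naturality_apply η (CommAlgCat.ofHom f) x.pt).symm

end FunctorSpace

/-! ### The affine Grassmannian of `GL_n` and convolution products -/

section Grassmannian

variable (k : Type u) [Field k] (n e : ℕ)

/-- The affine Grassmannian `Gr` of `GL_n` over `k`, sending `R` to the set of lattices in
`R((u))^n`. -/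
def affineGr : CommAlgCat.{u} k ⥤ Type u where
  obj R := LaurentLattice n R
  map f := TypeCat.ofHom fun L => L.map f.hom.toRingHom
  map_id _ := by
    apply ConcreteCategory.hom_ext
    exact fun L => L.map_id
  map_comp f g := by
    apply ConcreteCategory.hom_ext
    exact fun L => L.map_comp f.hom.toRingHom g.hom.toRingHom

/-- The strata `Gr_a = {L | Inv(L, L_0) = a}` of the affine Grassmannian. -/
def affineGrStratum (a : DominantCocharacter n) : Set (FunctorSpace (affineGr k n)) :=
  {p | ∃ (K : Type u) (_ : Field K) (_ : Algebra k K) (L : LaurentLattice n K),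
    p = FieldPoint.toSpace (F := affineGr k n) ⟨K, L⟩ ∧ L.HasRelPos (LaurentLattice.std n K) a}

/-- An `R`-point of the `e`-fold convolution product: a chain of modifications
`L_e ⇢ ... ⇢ L_1 ⇢ L_0` of lattices in `R((u))^n`, where `L_0 = R[[u]]^n` is the standard lattice
(the modifications being induced by the identity of `R((u))^n`). -/
@[ext]
structure LatticeChain (R : Type*) [CommRing R] where
  lattice : Fin (e + 1) → LaurentLattice n R
  lattice_zero : lattice 0 = LaurentLattice.std n R

/-- The `e`-fold convolution product of the affine Grassmannian of `GL_n`. -/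
def convolutionGr : CommAlgCat.{u} k ⥤ Type u where
  obj R := LatticeChain n e R
  map f := TypeCat.ofHom fun c =>
    { lattice := fun i => (c.lattice i).map f.hom.toRingHom
      lattice_zero := by rw [c.lattice_zero, LaurentLattice.map_std] }
  map_id _ := by
    apply ConcreteCategory.hom_ext
    exact fun c => LatticeChain.ext (funext fun i => (c.lattice i).map_id)
  map_comp f g := by
    apply ConcreteCategory.hom_ext
    exact fun c => LatticeChain.ext (funext fun i =>
      (c.lattice i).map_comp f.hom.toRingHom g.hom.toRingHom)

/-- The convolution morphism `m`, sending a chain `L_e ⇢ ... ⇢ L_0` to `L_e`. -/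
def convolutionMorphism : convolutionGr k n e ⟶ affineGr k n where
  app _ := TypeCat.ofHom fun c => c.lattice (Fin.last e)

/-- The locus `Gr_{μ_1} ×~ ... ×~ Gr_{μ_e}` of the convolution product, given by the chains with
`Inv(L_i, L_{i-1}) = μ_i` for `i = 1, ..., e`, as a subset of the topological space of the
convolution product. -/
def convolutionStratum (μ : Fin e → DominantCocharacter n) :
    Set (FunctorSpace (convolutionGr k n e)) :=
  {p | ∃ (K : Type u) (_ : Field K) (_ : Algebra k K) (c : LatticeChain n e K),
    p = FieldPoint.toSpace (F := convolutionGr k n e) ⟨K, c⟩ ∧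
      ∀ i : Fin e, (c.lattice i.succ).HasRelPos (c.lattice i.castSucc) (μ i)}

end Grassmannian

end

/-! A lattice `Λ` with `Inv(Λ, Λ₀) = (a, b)` lies in `u^m Λ₀` exactly when `m ≤ b`
(`LaurentLattice.HasRelPos.coeffVanish_iff`). Along a chain of modifications of type `(1,0)` the sum
`a + b` grows by one at each step and `b` never decreases (`LatticeChain.exists_hasRelPos`). So `a +
b = e` and `b ≥ 0` at the end: each point of the convolution locus lies in exactly one `X_λ`, and
`b` determines `λ`. Dominance reverses the order of second entries, hence the union of the `X_λ'`
with `λ' ≤ (a, b)` is the locus `Λ_e ⊆ u^b Λ₀`. It is cut out by the vanishing of coefficients,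
hence closed (`isClosed_vanishingLocus`), which bounds the closure from above.

Conversely, a point with `Λ_e ⊆ u^b Λ₀`, `b ≥ 0`, is a specialization of one for which `b` is
optimal (`exists_specializes_coeffVanish`). Over a field `K` the chain comes from products of
matrices `h_i diag(u, 1)` with `h_i` constant. Multiplying `h_i` on the right by `(1, ε_i t; 0, 1)`
gives a family over `K[t]` that restricts to the given chain at `t = 0`. The `ε_i` are found by
induction on the length (`exists_deformMatrix_coeffVanish`). If `Λ_{m+1} ⊆ u^{b+1} Λ₀`, then `u Λ_m
⊆ Λ_{m+1}` gives `Λ_m ⊆ u^b Λ₀`, and `Λ_m` can be deformed until `b` is optimal for it. All its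
modifications stay in `u^b Λ₀`; two distinct ones span it, so they are not both in `u^{b+1} Λ₀`. -/

noncomputable section

/-! ### Vanishing orders of submodules of `R((u))^n` -/

section CoeffVanish

variable {n : ℕ} {R S : Type*} [CommRing R] [CommRing S]

/-- All coordinates of elements of `N` lie in `u^m R[[u]]`. -/
def CoeffVanish (m : ℤ) (N : Submodule R⟦X⟧ (Fin n → R⸨X⸩)) : Prop :=
  ∀ v ∈ N, ∀ i, ∀ j < m, (v i).coeff j = 0

theorem coeff_powerSeries_smul_eq_zero {m : ℤ} {x : R⸨X⸩} (hx : ∀ j < m, x.coeff j = 0)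
    (a : R⟦X⟧) : ∀ j < m, (a • x).coeff j = 0 := by
  intro j hj
  rw [← algebraMap_smul R⸨X⸩ a x, smul_eq_mul, HahnSeries.coeff_mul]
  refine Finset.sum_eq_zero fun p hp => ?_
  rw [Finset.mem_antidiagonal] at hp
  by_cases h : p.1 < 0
  · have : (algebraMap R⟦X⟧ R⸨X⸩ a).coeff p.1 = 0 := by
      change (HahnSeries.ofPowerSeries ℤ R a).coeff p.1 = 0
      rw [PowerSeries.coeff_coe, if_pos h]
    rw [this, zero_mul]
  · rw [hx p.2 (by have := hp.2.2; omega), mul_zero]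

theorem coeffVanish_span {m : ℤ} {s : Set (Fin n → R⸨X⸩)} :
    CoeffVanish m (Submodule.span R⟦X⟧ s) ↔ ∀ v ∈ s, ∀ i, ∀ j < m, (v i).coeff j = 0 := by
  refine ⟨fun h v hv => h v (Submodule.subset_span hv), fun h v hv i => ?_⟩
  induction hv using Submodule.span_induction with
  | mem v hv => exact h v hv i
  | zero => intro j _; simp
  | add v w _ _ hv hw =>
    intro j hj
    rw [Pi.add_apply, HahnSeries.coeff_add, hv j hj, hw j hj, add_zero]
  | smul c v _ hv => exact coeff_powerSeries_smul_eq_zero hv c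

theorem CoeffVanish.mono {m : ℤ} {N N' : Submodule R⟦X⟧ (Fin n → R⸨X⸩)} (h : CoeffVanish m N')
    (hN : N ≤ N') : CoeffVanish m N :=
  fun v hv => h v (hN hv)

theorem CoeffVanish.of_le {m m' : ℤ} {N : Submodule R⟦X⟧ (Fin n → R⸨X⸩)} (h : CoeffVanish m' N)
    (hm : m ≤ m') : CoeffVanish m N :=
  fun v hv i j hj => h v hv i j (hj.trans_le hm)

/-- Base change turns the condition into equations on the coefficients of `L` itself. This gives
both invariance under field extension and closedness in families. -/
theorem coeffVanish_map {m : ℤ} (f : R →+* S) (L : LaurentLattice n R) :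
    CoeffVanish m (L.map f).carrier ↔ ∀ v ∈ L.carrier, ∀ i, ∀ j < m, f ((v i).coeff j) = 0 := by
  change CoeffVanish m (Submodule.span S⟦X⟧ _) ↔ _
  rw [coeffVanish_span]
  refine ⟨fun h v hv => h _ ⟨v, hv, rfl⟩, ?_⟩
  rintro h _ ⟨v, hv, rfl⟩
  exact h v hv

theorem coeffVanish_map_iff {m : ℤ} (f : R →+* S) (hf : Function.Injective f)
    (L : LaurentLattice n R) : CoeffVanish m (L.map f).carrier ↔ CoeffVanish m L.carrier := by
  rw [coeffVanish_map]
  simp only [map_eq_zero_iff f hf]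
  rfl

theorem X_smul_coeff (x : R⸨X⸩) (j : ℤ) :
    ((PowerSeries.X : R⟦X⟧) • x).coeff j = x.coeff (j - 1) := by
  have : algebraMap R⟦X⟧ R⸨X⸩ PowerSeries.X = HahnSeries.single 1 1 := by
    change HahnSeries.ofPowerSeries ℤ R _ = _
    simp
  rw [← algebraMap_smul R⸨X⸩ _ x, this, smul_eq_mul, HahnSeries.coeff_single_mul, one_mul]

theorem single_zero_smul (r : R) (v : Fin n → R⸨X⸩) :
    (HahnSeries.single (0 : ℤ) r : R⸨X⸩) • v = (PowerSeries.C r : R⟦X⟧) • v := by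
  have : algebraMap R⟦X⟧ R⸨X⸩ (PowerSeries.C r) = HahnSeries.single 0 r := by
    change HahnSeries.ofPowerSeries ℤ R _ = _
    simp [HahnSeries.C_apply]
  rw [← algebraMap_smul R⸨X⸩ (PowerSeries.C r) v, this]

theorem single_one_smul (v : Fin n → R⸨X⸩) :
    (HahnSeries.single (1 : ℤ) (1 : R) : R⸨X⸩) • v = (PowerSeries.X : R⟦X⟧) • v := by
  ext i j
  rw [Pi.smul_apply, Pi.smul_apply, X_smul_coeff, smul_eq_mul, HahnSeries.coeff_single_mul, one_mul]

theorem mem_std_iff (v : Fin n → R⸨X⸩) :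
    v ∈ (LaurentLattice.std n R).carrier ↔ ∀ i, ∀ j < 0, (v i).coeff j = 0 := by
  change v ∈ Submodule.span R⟦X⟧ _ ↔ _
  refine ⟨fun hv => ?_, fun hv => ?_⟩
  · have : CoeffVanish 0
      (Submodule.span R⟦X⟧ (Set.range fun i : Fin n => (Pi.single i 1 : Fin n → R⸨X⸩))) := by
      rw [coeffVanish_span]
      rintro _ ⟨l, rfl⟩ i j hj
      by_cases h : i = l
      · subst h
        simp [HahnSeries.coeff_one, hj.ne]
      · simp [Pi.single_eq_of_ne h]
    exact this v hv
  · rw [Submodule.mem_span_range_iff_exists_fun]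
    refine ⟨fun i => PowerSeries.mk fun l => (v i).coeff l, ?_⟩
    ext i j
    rw [Finset.sum_apply, Finset.sum_eq_single i]
    · rw [Pi.smul_apply, Pi.single_eq_same, Algebra.smul_def, mul_one]
      change (HahnSeries.ofPowerSeries ℤ R _).coeff j = _
      rw [PowerSeries.coeff_coe]
      split_ifs with h
      · rw [hv i j h]
      · rw [PowerSeries.coeff_mk, Int.natAbs_of_nonneg (not_lt.1 h)]
    · intro l _ hl
      rw [Pi.smul_apply, Pi.single_eq_of_ne hl.symm, smul_zero]
    · simp

end CoeffVanish

/-! ### Relative positions -/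

section RelPos

variable {K : Type*} [Field K] {n : ℕ}

/-- The `n` generators span the `n`-dimensional space over the field `K((u))`, so they are
independent there, hence over `K[[u]]`. -/
theorem LaurentLattice.linearIndependent_of_span (L : LaurentLattice n K)
    (v : Fin n → Fin n → K⸨X⸩) (hv : L.carrier = Submodule.span K⟦X⟧ (Set.range v)) :
    LinearIndependent K⟦X⟧ v := by
  have h : LinearIndependent K⸨X⸩ v := by
    refine linearIndependent_of_top_le_span_of_card_eq_finrank ?_ (by simp)
    rw [← L.span_eq_top, hv, Submodule.span_le]
    exact Submodule.span_subset_span _ _ _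
  refine LinearIndependent.restrict_scalars ?_ h
  intro a b hab
  simp only [Algebra.smul_def, mul_one] at hab
  exact algebraMap_laurent_injective hab

theorem LaurentLattice.hasRelPos_iff {L L' : LaurentLattice n K} {a : DominantCocharacter n} :
    L.HasRelPos L' a ↔ ∃ v : Fin n → Fin n → K⸨X⸩,
      L'.carrier = Submodule.span K⟦X⟧ (Set.range v) ∧
      L.carrier = Submodule.span K⟦X⟧
        (Set.range fun i => (HahnSeries.single (a.toFun i) (1 : K) : K⸨X⸩) • v i) := by
  constructor
  · rintro ⟨b, hb⟩
    refine ⟨fun i => b i, ?_, hb⟩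
    have h := congrArg (Submodule.map L'.carrier.subtype) b.span_eq
    rw [Submodule.map_span, Submodule.map_top, Submodule.range_subtype, ← Set.range_comp] at h
    exact h.symm
  · rintro ⟨v, hv, hL⟩
    let b := (Module.Basis.span (L'.linearIndependent_of_span v hv)).map
      (LinearEquiv.ofEq _ _ hv.symm)
    refine ⟨b, ?_⟩
    have hb : ∀ i, (b i : Fin n → K⸨X⸩) = v i := fun i => by
      simp [b, Module.Basis.span_apply]
    simp only [hb]
    exact hL

theorem range_fin_two {α : Type*} (f : Fin 2 → α) : Set.range f = {f 0, f 1} := by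
  ext x
  simp [Fin.exists_fin_two, eq_comm]

theorem LaurentLattice.hasRelPos_two_iff {L L' : LaurentLattice 2 K} {a : DominantCocharacter 2} :
    L.HasRelPos L' a ↔ ∃ v w : Fin 2 → K⸨X⸩,
      L'.carrier = Submodule.span K⟦X⟧ {v, w} ∧
      L.carrier = Submodule.span K⟦X⟧
        {(HahnSeries.single (a.toFun 0) (1 : K) : K⸨X⸩) • v,
          (HahnSeries.single (a.toFun 1) (1 : K) : K⸨X⸩) • w} := by
  rw [hasRelPos_iff]
  simp only [range_fin_two]
  exact ⟨fun ⟨v, h⟩ => ⟨v 0, v 1, h⟩, fun ⟨v, w, h⟩ => ⟨![v, w], by simpa using h⟩⟩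

/-- The second entry is the order of divisibility by `u`: a larger order would make the basis vector
`w` of `Λ₀` divisible by `u` in `Λ₀`. -/
theorem LaurentLattice.HasRelPos.coeffVanish_iff {L : LaurentLattice 2 K}
    {a : DominantCocharacter 2} (h : L.HasRelPos (LaurentLattice.std 2 K) a) (m : ℤ) :
    CoeffVanish m L.carrier ↔ m ≤ a.toFun 1 := by
  obtain ⟨v, w, hv, hL⟩ := hasRelPos_two_iff.1 h
  have ha : a.toFun 1 ≤ a.toFun 0 := a.antitone (Fin.zero_le 1)
  have hmem : ∀ x ∈ ({v, w} : Set (Fin 2 → K⸨X⸩)), ∀ i, ∀ j < 0, (x i).coeff j = 0 :=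
    fun x hx => (mem_std_iff x).1 (hv ▸ Submodule.subset_span hx)
  rw [hL, coeffVanish_span]
  constructor
  · intro hm
    by_contra! hlt
    let w' : Fin 2 → K⸨X⸩ := (HahnSeries.single (-1 : ℤ) (1 : K) : K⸨X⸩) • w
    have hw' : w' ∈ (LaurentLattice.std 2 K).carrier := by
      rw [mem_std_iff]
      intro i j hj
      have h1 := hm _ (Set.mem_insert_of_mem _ rfl) i (j + 1 + a.toFun 1) (by omega)
      simp only [Pi.smul_apply, smul_eq_mul, HahnSeries.coeff_single_mul, one_mul, w'] at h1 ⊢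
      rw [← h1]
      congr 1
      ring
    have hXw : (PowerSeries.X : K⟦X⟧) • w' = w := by
      rw [← single_one_smul, smul_smul, HahnSeries.single_mul_single]
      simp
    rw [hv, Submodule.mem_span_pair] at hw'
    obtain ⟨p, q, hpq⟩ := hw'
    have hli : LinearIndependent K⟦X⟧ ![v, w] :=
      (LaurentLattice.std 2 K).linearIndependent_of_span ![v, w] (by rw [range_fin_two]; exact hv)
    rw [LinearIndependent.pair_iff] at hli
    -- Expanding `u^{-1} w = p v + q w` and multiplying by `u` gives a relation whose
    -- `w`-coefficient `u q - 1` has constant term `-1`.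
    have h2 := (hli (PowerSeries.X * p) (PowerSeries.X * q - 1) (by
      rw [sub_smul, mul_smul, mul_smul, one_smul, ← add_sub_assoc, ← smul_add, hpq, hXw,
        sub_self])).2
    have h3 := congrArg PowerSeries.constantCoeff h2
    simp at h3
  · rintro hm x (rfl | rfl) i j hj
    · rw [Pi.smul_apply, smul_eq_mul, HahnSeries.coeff_single_mul, one_mul]
      exact hmem v (Set.mem_insert _ _) i _ (by omega)
    · rw [Pi.smul_apply, smul_eq_mul, HahnSeries.coeff_single_mul, one_mul]
      exact hmem w (Set.mem_insert_of_mem _ rfl) i _ (by omega)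

end RelPos

/-! ### Elementary modifications of lattices -/

section Step

variable {K : Type*} [Field K]

theorem span_pair_add_smul {S M : Type*} [CommRing S] [AddCommGroup M] [Module S M] (v w : M)
    (x : S) : Submodule.span S {v, w + x • v} = Submodule.span S {v, w} := by
  apply le_antisymm
  · rw [Submodule.span_le, Set.pair_subset_iff, SetLike.mem_coe, SetLike.mem_coe,
      Submodule.mem_span_pair, Submodule.mem_span_pair]
    exact ⟨⟨1, 0, by module⟩, x, 1, by module⟩
  · rw [Submodule.span_le, Set.pair_subset_iff, SetLike.mem_coe, SetLike.mem_coe,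
      Submodule.mem_span_pair, Submodule.mem_span_pair]
    exact ⟨⟨1, 0, by module⟩, -x, 1, by module⟩

/-- A modification of type `(1,0)` of the lattice spanned by `A` and `B`, in terms of `A`, `B`,
over a local ring with principal maximal ideal generated by `π` and residues represented by
`C`. -/
theorem exists_span_modification {S Z M : Type*} [CommRing S] [AddCommGroup M] [Module S M]
    {π : S} {C : Z → S} (hπ : ¬ IsUnit π) (hS : ∀ x : S, IsUnit x ∨ π ∣ x)
    (hC : ∀ x : S, ∃ z, π ∣ x - C z) {A B c d : M}
    (hspan : Submodule.span S {A, B} = Submodule.span S {c, d})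
    (hli : LinearIndependent S ![c, d]) :
    (∃ z : Z, Submodule.span S {π • c, d} = Submodule.span S {π • A, B + C z • A}) ∨
    Submodule.span S {π • c, d} = Submodule.span S {π • B, A} := by
  have hc : c ∈ Submodule.span S {A, B} := hspan ▸ Submodule.subset_span (by simp)
  have hd : d ∈ Submodule.span S {A, B} := hspan ▸ Submodule.subset_span (by simp)
  have hA : A ∈ Submodule.span S {c, d} := hspan ▸ Submodule.subset_span (by simp)
  have hB : B ∈ Submodule.span S {c, d} := hspan ▸ Submodule.subset_span (by simp)
  rw [Submodule.mem_span_pair] at hc hd hA hB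
  obtain ⟨p, q, rfl⟩ := hc
  obtain ⟨α, β, rfl⟩ := hd
  obtain ⟨r, s, hA⟩ := hA
  obtain ⟨r', s', hB⟩ := hB
  -- The modification contains `π` times the whole lattice, so only the line spanned by `d` modulo
  -- `π` matters: a point of the projective line in the coordinates `(α, β)`.
  have hXA : π • A ∈ Submodule.span S {π • (p • A + q • B), α • A + β • B} := by
    rw [Submodule.mem_span_pair]
    refine ⟨r, π * s, ?_⟩
    linear_combination (norm := module) π • hA
  have hXB : π • B ∈ Submodule.span S {π • (p • A + q • B), α • A + β • B} := by
    rw [Submodule.mem_span_pair]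
    refine ⟨r', π * s', ?_⟩
    linear_combination (norm := module) π • hB
  have hd : α • A + β • B ∈ Submodule.span S {π • (p • A + q • B), α • A + β • B} :=
    Submodule.subset_span (by simp)
  -- For `β` a unit the line is that of `B + (α/β) A`, and `α/β` may be replaced by its
  -- representative `C z`. Otherwise it is the line of `A`.
  rcases hS β with hβ | ⟨β', rfl⟩
  · obtain ⟨γ, hγ⟩ := hβ.exists_left_inv
    obtain ⟨z, ζ, hζ⟩ := hC (γ * α)
    refine Or.inl ⟨z, ?_⟩
    apply le_antisymm
    · rw [Submodule.span_le, Set.pair_subset_iff, SetLike.mem_coe, SetLike.mem_coe,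
        Submodule.mem_span_pair, Submodule.mem_span_pair]
      refine ⟨⟨p - q * C z, π * q, by module⟩, β * ζ, β, ?_⟩
      linear_combination (norm := module) (-β * hζ + α * hγ) • A
    · rw [Submodule.span_le, Set.pair_subset_iff]
      refine ⟨hXA, ?_⟩
      have h : γ • (α • A + β • B) - ζ • π • A = B + C z • A := by
        linear_combination (norm := module) hγ • B + hζ • A
      have hmem := Submodule.sub_mem _ (Submodule.smul_mem _ γ hd) (Submodule.smul_mem _ ζ hXA)
      rwa [h] at hmem
  · rcases hS α with hα | ⟨α', rfl⟩
    · right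
      obtain ⟨γ, hγ⟩ := hα.exists_left_inv
      apply le_antisymm
      · rw [Submodule.span_le, Set.pair_subset_iff, SetLike.mem_coe, SetLike.mem_coe,
          Submodule.mem_span_pair, Submodule.mem_span_pair]
        exact ⟨⟨q, π * p, by module⟩, β', α, by module⟩
      · rw [Submodule.span_le, Set.pair_subset_iff]
        refine ⟨hXB, ?_⟩
        have h : γ • (α • A + (π * β') • B) - (γ * β') • π • B = A := by
          linear_combination (norm := module) hγ • A
        have hmem := Submodule.sub_mem _ (Submodule.smul_mem _ γ hd)
          (Submodule.smul_mem _ (γ * β') hXB)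
        rwa [h] at hmem
    -- If `π` divided both coordinates, `d` would be `π` times a combination of `c` and `d`, and
    -- independence would make `π` a unit.
    · exfalso
      rw [LinearIndependent.pair_iff] at hli
      have h := (hli (π * (α' * r + β' * r')) (π * (α' * s + β' * s') - 1) (by
          linear_combination (norm := module) (π * α') • hA + (π * β') • hB)).2
      exact hπ (IsUnit.of_mul_eq_one _ (sub_eq_zero.1 h))

theorem exists_span_powerSeries_modification {M : Type*} [AddCommGroup M] [Module K⟦X⟧ M]
    {A B c d : M} (hspan : Submodule.span K⟦X⟧ {A, B} = Submodule.span K⟦X⟧ {c, d})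
    (hli : LinearIndependent K⟦X⟧ ![c, d]) :
    (∃ z : K, Submodule.span K⟦X⟧ {(PowerSeries.X : K⟦X⟧) • c, d} =
      Submodule.span K⟦X⟧ {(PowerSeries.X : K⟦X⟧) • A, B + (PowerSeries.C z : K⟦X⟧) • A}) ∨
    Submodule.span K⟦X⟧ {(PowerSeries.X : K⟦X⟧) • c, d} =
      Submodule.span K⟦X⟧ {(PowerSeries.X : K⟦X⟧) • B, A} := by
  refine exists_span_modification ?_ (fun x => ?_)
    (fun x => ⟨PowerSeries.constantCoeff x, PowerSeries.X_dvd_iff.2 (by simp)⟩) hspan hli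
  · simp [PowerSeries.isUnit_iff_constantCoeff]
  · rw [PowerSeries.isUnit_iff_constantCoeff, isUnit_iff_ne_zero, PowerSeries.X_dvd_iff]
    exact (em _).symm

/-- The dominant cocharacter `(a, b)` of `GL_2`. -/
def dominantPair (a b : ℤ) (h : b ≤ a) : DominantCocharacter 2 where
  toFun := ![a, b]
  antitone i j hij := by
    fin_cases i <;> fin_cases j <;> simp_all

variable {L L' L₀ : LaurentLattice 2 K}

theorem LaurentLattice.HasRelPos.exists_modification {μ : DominantCocharacter 2}
    (hμ : μ.toFun = ![1, 0]) (h : L'.HasRelPos L μ) {A B : Fin 2 → K⸨X⸩}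
    (hL : L.carrier = Submodule.span K⟦X⟧ {A, B}) :
    (∃ z : K, L'.carrier = Submodule.span K⟦X⟧
      {(PowerSeries.X : K⟦X⟧) • A, B + (PowerSeries.C z : K⟦X⟧) • A}) ∨
    L'.carrier = Submodule.span K⟦X⟧ {(PowerSeries.X : K⟦X⟧) • B, A} := by
  obtain ⟨c, d, hcd, hL'⟩ := hasRelPos_two_iff.1 h
  have h1 : (HahnSeries.single (μ.toFun 1) (1 : K) : K⸨X⸩) • d = d := by
    have : (HahnSeries.single (0 : ℤ) (1 : K) : K⸨X⸩) = 1 := rfl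
    simp [hμ, this]
  have h0 : (HahnSeries.single (μ.toFun 0) (1 : K) : K⸨X⸩) • c = (PowerSeries.X : K⟦X⟧) • c := by
    rw [hμ]
    exact single_one_smul c
  rw [h0, h1] at hL'
  rw [hL']
  exact exists_span_powerSeries_modification (hL.symm.trans hcd)
    (L.linearIndependent_of_span ![c, d] (by rw [range_fin_two]; exact hcd))

theorem single_smul_single_smul (a b : ℤ) (v : Fin 2 → K⸨X⸩) :
    (HahnSeries.single a (1 : K) : K⸨X⸩) • (HahnSeries.single b (1 : K) : K⸨X⸩) • v =
      (HahnSeries.single (a + b) (1 : K) : K⸨X⸩) • v := by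
  rw [smul_smul, HahnSeries.single_mul_single, one_mul]

/-- Take `A = u^{a₀} v` and `B = u^{a₁} w` for a basis `v`, `w` of `L₀` adapted to `L`. Each of the
two kinds of modification raises one exponent by one, after a change of basis of `L₀`. -/
theorem LaurentLattice.HasRelPos.exists_of_modification {μ a : DominantCocharacter 2}
    (hμ : μ.toFun = ![1, 0]) (h' : L'.HasRelPos L μ) (h : L.HasRelPos L₀ a) :
    ∃ a' : DominantCocharacter 2, L'.HasRelPos L₀ a' ∧
      a'.toFun 0 + a'.toFun 1 = a.toFun 0 + a.toFun 1 + 1 ∧ a.toFun 1 ≤ a'.toFun 1 := by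
  obtain ⟨v, w, hvw, hL⟩ := hasRelPos_two_iff.1 h
  have ha : a.toFun 1 ≤ a.toFun 0 := a.antitone (Fin.zero_le 1)
  rcases h'.exists_modification hμ hL with ⟨z, hL'⟩ | hL'
  -- Because `a₁ ≤ a₀`, `B + z A = u^{a₁} (w + z u^{a₀ - a₁} v)`, so replacing `w` by the bracket
  -- keeps a basis of `L₀`.
  · refine ⟨dominantPair (a.toFun 0 + 1) (a.toFun 1) (by omega), hasRelPos_two_iff.2
      ⟨v, w + (PowerSeries.C z * PowerSeries.X ^ (a.toFun 0 - a.toFun 1).toNat : K⟦X⟧) • v,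
        ?_, ?_⟩, by simp [dominantPair]; ring, le_rfl⟩
    · rw [hvw, span_pair_add_smul]
    · rw [hL']
      have hX : algebraMap K⟦X⟧ K⸨X⸩ (PowerSeries.X ^ (a.toFun 0 - a.toFun 1).toNat) =
          HahnSeries.single (a.toFun 0 - a.toFun 1) 1 := by
        rw [← Int.toNat_of_nonneg (sub_nonneg.2 ha)]
        change HahnSeries.ofPowerSeries ℤ K _ = _
        simp
      congr 2
      · rw [← single_one_smul, single_smul_single_smul, add_comm]
        rfl
      · rw [Set.singleton_eq_singleton_iff, smul_add, ← algebraMap_smul K⸨X⸩ (_ * _ : K⟦X⟧) v,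
          ← algebraMap_smul K⸨X⸩ (PowerSeries.C z) (_ : Fin 2 → K⸨X⸩), map_mul, hX, smul_smul,
          smul_smul, mul_left_comm, HahnSeries.single_mul_single]
        simp [dominantPair]
  · rcases ha.lt_or_eq with hlt | heq
    · refine ⟨dominantPair (a.toFun 0) (a.toFun 1 + 1) (by omega), hasRelPos_two_iff.2
        ⟨v, w, hvw, ?_⟩, by simp [dominantPair]; ring, by simp [dominantPair]⟩
      rw [hL', ← single_one_smul, single_smul_single_smul, Set.pair_comm, add_comm]
      rfl
    -- For equal exponents, raising the second would break dominance, so the two basis vectors are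
    -- exchanged.
    · refine ⟨dominantPair (a.toFun 1 + 1) (a.toFun 0) (by omega), hasRelPos_two_iff.2
        ⟨w, v, by rw [hvw, Set.pair_comm], ?_⟩, by simp [dominantPair]; ring,
          by simp [dominantPair, heq]⟩
      rw [hL', ← single_one_smul, single_smul_single_smul, add_comm]
      rfl

theorem LaurentLattice.hasRelPos_self (L : LaurentLattice 2 K) {A B : Fin 2 → K⸨X⸩}
    (hL : L.carrier = Submodule.span K⟦X⟧ {A, B}) :
    L.HasRelPos L (dominantPair 0 0 le_rfl) := by
  refine hasRelPos_two_iff.2 ⟨A, B, hL, ?_⟩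
  have : (HahnSeries.single (0 : ℤ) (1 : K) : K⸨X⸩) = 1 := rfl
  simpa [dominantPair, this] using hL

theorem LatticeChain.exists_hasRelPos {e : ℕ} {μ : Fin e → DominantCocharacter 2}
    (hμ : ∀ i, (μ i).toFun = ![1, 0]) (c : LatticeChain 2 e K)
    (hc : ∀ i : Fin e, (c.lattice i.succ).HasRelPos (c.lattice i.castSucc) (μ i))
    (m : Fin (e + 1)) :
    ∃ a : DominantCocharacter 2, (c.lattice m).HasRelPos (LaurentLattice.std 2 K) a ∧
      a.toFun 0 + a.toFun 1 = m ∧ 0 ≤ a.toFun 1 := by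
  induction m using Fin.induction with
  | zero =>
    refine ⟨dominantPair 0 0 le_rfl, ?_, by simp [dominantPair]⟩
    rw [c.lattice_zero]
    exact LaurentLattice.hasRelPos_self _ (A := Pi.single 0 1) (B := Pi.single 1 1)
      (congrArg (Submodule.span K⟦X⟧) (range_fin_two _))
  | succ i ih =>
    obtain ⟨a, ha, hsum, hnonneg⟩ := ih
    obtain ⟨a', ha', hsum', hle⟩ := (hc i).exists_of_modification (hμ i) ha
    exact ⟨a', ha', by rw [hsum', hsum]; simp, hnonneg.trans hle⟩

end Step

/-! ### Lattices with a basis -/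

section MatrixLattice

variable {n : ℕ} {R S : Type*} [CommRing R] [CommRing S]

/-- The lattice spanned by the columns of an invertible matrix over `R((u))`. -/
def LaurentLattice.ofMatrix (g : GL (Fin n) R⸨X⸩) : LaurentLattice n R :=
  LaurentLattice.ofDualBasis
    (Submodule.span R⟦X⟧ (Set.range fun j : Fin n => g.1.transpose j)) <| by
      refine ⟨n, fun j => g.1.transpose j, fun j => g⁻¹.1 j,
        fun i => Submodule.subset_span ⟨i, rfl⟩, fun j v hv => ?_, fun v => ?_⟩
      · induction hv using Submodule.span_induction with
        | mem v hv =>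
          obtain ⟨i, rfl⟩ := hv
          have h : g⁻¹.1 j ⬝ᵥ g.1.transpose i = (g⁻¹.1 * g.1) j i := rfl
          simp only [h, Units.inv_mul]
          by_cases h : j = i
          · subst h
            exact ⟨1, by rw [Matrix.one_apply_eq, map_one]⟩
          · exact ⟨0, by rw [Matrix.one_apply_ne h, map_zero]⟩
        | zero => exact ⟨0, by simp⟩
        | add v w _ _ hv hw =>
          obtain ⟨a, ha⟩ := hv
          obtain ⟨b, hb⟩ := hw
          exact ⟨a + b, by rw [dotProduct_add, ha, hb, map_add]⟩
        | smul c v _ hv =>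
          obtain ⟨a, ha⟩ := hv
          exact ⟨c * a, by
            rw [← algebraMap_smul R⸨X⸩ c, dotProduct_smul, ha, smul_eq_mul, map_mul]⟩
      · have h : g.1.mulVec (g⁻¹.1.mulVec v) = v := by
          rw [Matrix.mulVec_mulVec, Units.mul_inv, Matrix.one_mulVec]
        refine Eq.trans (funext fun i => ?_) h
        rw [Finset.sum_apply]
        exact Finset.sum_congr rfl fun j _ => mul_comm _ _

theorem LaurentLattice.ofMatrix_carrier (g : GL (Fin n) R⸨X⸩) : (ofMatrix g).carrier =
    Submodule.span R⟦X⟧ (Set.range fun j : Fin n => g.1.transpose j) := rfl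

theorem LaurentLattice.ofMatrix_one : ofMatrix (1 : GL (Fin n) R⸨X⸩) = std n R := by
  refine LaurentLattice.ext (congrArg (fun s => Submodule.span R⟦X⟧ (Set.range s)) ?_)
  funext j i
  simp [Matrix.one_apply, Pi.single_apply]

theorem LaurentLattice.map_ofMatrix (f : R →+* S) (g : GL (Fin n) R⸨X⸩) :
    (ofMatrix g).map f = ofMatrix (Matrix.GeneralLinearGroup.map (laurentMap f) g) := by
  refine LaurentLattice.ext ?_
  change Submodule.span S⟦X⟧ (laurentVecMap f '' ((ofMatrix g).carrier : Set (Fin n → R⸨X⸩))) =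
    Submodule.span S⟦X⟧ _
  refine le_antisymm (Submodule.span_le.2 ?_) (Submodule.span_le.2 ?_)
  · rintro _ ⟨w, hw, rfl⟩
    rw [SetLike.mem_coe] at hw ⊢
    rw [ofMatrix_carrier] at hw
    induction hw using Submodule.span_induction with
    | mem w hw =>
      obtain ⟨j, rfl⟩ := hw
      exact Submodule.subset_span ⟨j, rfl⟩
    | zero =>
      have : laurentVecMap f (0 : Fin n → R⸨X⸩) = 0 := funext fun _ => map_zero _
      rw [this]
      exact Submodule.zero_mem _
    | add v w _ _ hv hw => rw [laurentVecMap_add]; exact Submodule.add_mem _ hv hw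
    | smul c v _ hv => rw [laurentVecMap_smul']; exact Submodule.smul_mem _ _ hv
  · rintro _ ⟨j, rfl⟩
    exact Submodule.subset_span ⟨_, Submodule.subset_span ⟨j, rfl⟩, rfl⟩

theorem LaurentLattice.ofMatrix_carrier_two (g : GL (Fin 2) R⸨X⸩) : (ofMatrix g).carrier =
    Submodule.span R⟦X⟧ {g.1.transpose 0, g.1.transpose 1} := by
  rw [ofMatrix_carrier, range_fin_two]

variable (R) in
/-- The matrix `diag(u, 1)`. -/
def diagU : GL (Fin 2) R⸨X⸩ where
  val := !![HahnSeries.single 1 1, 0; 0, 1]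
  inv := !![HahnSeries.single (-1) 1, 0; 0, 1]
  val_inv := by
    have : (HahnSeries.single (0 : ℤ) (1 : R) : R⸨X⸩) = 1 := rfl
    simp [Matrix.one_fin_two, this]
  inv_val := by
    have : (HahnSeries.single (0 : ℤ) (1 : R) : R⸨X⸩) = 1 := rfl
    simp [Matrix.one_fin_two, this]

/-- The constant matrix `h` followed by `diag(u, 1)`. -/
def stepMatrix (h : GL (Fin 2) R) : GL (Fin 2) R⸨X⸩ :=
  Matrix.GeneralLinearGroup.map (HahnSeries.C : R →+* R⸨X⸩) h * diagU R

theorem laurentMap_single (f : R →+* S) (a : ℤ) (r : R) :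
    laurentMap f (HahnSeries.single a r) = HahnSeries.single a (f r) := by
  ext i
  change f ((HahnSeries.single a r).coeff i) = _
  by_cases h : i = a
  · subst h
    rw [HahnSeries.coeff_single_same, HahnSeries.coeff_single_same]
  · rw [HahnSeries.coeff_single_of_ne h, HahnSeries.coeff_single_of_ne h, map_zero]

theorem map_stepMatrix (f : R →+* S) (h : GL (Fin 2) R) :
    Matrix.GeneralLinearGroup.map (laurentMap f) (stepMatrix h) =
      stepMatrix (Matrix.GeneralLinearGroup.map f h) := by
  have hC : ∀ r : R, laurentMap f (HahnSeries.C r) = HahnSeries.C (f r) :=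
    fun r => laurentMap_single f 0 r
  have hu : laurentMap f (HahnSeries.single 1 1) = HahnSeries.single 1 1 := by
    rw [laurentMap_single, map_one]
  rw [stepMatrix, map_mul, stepMatrix]
  congr 1
  · refine Units.ext (Matrix.ext fun i j => ?_)
    simp only [Matrix.GeneralLinearGroup.map_apply, hC]
  · refine Units.ext (Matrix.ext fun i j => ?_)
    fin_cases i <;> fin_cases j <;> simp [diagU, hu]

theorem mul_stepMatrix_col_zero (g : GL (Fin 2) R⸨X⸩) (h : GL (Fin 2) R) :
    (g * stepMatrix h).1.transpose 0 = (PowerSeries.X : R⟦X⟧) •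
      ((PowerSeries.C (h 0 0) : R⟦X⟧) • g.1.transpose 0 +
        (PowerSeries.C (h 1 0) : R⟦X⟧) • g.1.transpose 1) := by
  rw [← single_zero_smul, ← single_zero_smul, ← single_one_smul]
  funext i
  simp only [stepMatrix, diagU, Units.val_mul, Matrix.transpose_apply, Matrix.mul_apply,
    Fin.sum_univ_two, Pi.smul_apply, Pi.add_apply, smul_eq_mul, HahnSeries.C_apply,
    Matrix.GeneralLinearGroup.map_apply, Matrix.of_apply, Matrix.cons_val_zero,
    Matrix.cons_val_one, Matrix.cons_val_fin_one]
  ring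

theorem mul_stepMatrix_col_one (g : GL (Fin 2) R⸨X⸩) (h : GL (Fin 2) R) :
    (g * stepMatrix h).1.transpose 1 = (PowerSeries.C (h 0 1) : R⟦X⟧) • g.1.transpose 0 +
        (PowerSeries.C (h 1 1) : R⟦X⟧) • g.1.transpose 1 := by
  rw [← single_zero_smul, ← single_zero_smul]
  funext i
  simp only [stepMatrix, diagU, Units.val_mul, Matrix.transpose_apply, Matrix.mul_apply,
    Fin.sum_univ_two, Pi.smul_apply, Pi.add_apply, smul_eq_mul, HahnSeries.C_apply,
    Matrix.GeneralLinearGroup.map_apply, Matrix.of_apply, Matrix.cons_val_zero,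
    Matrix.cons_val_one, Matrix.cons_val_fin_one]
  ring

/-- Serves to rewrite the lattice of `g` in the basis of columns of `g h`, which is adapted to the
modification `g h diag(u, 1)`. -/
theorem span_pair_GL {M : Type*} [AddCommGroup M] [Module R⟦X⟧ M] (h : GL (Fin 2) R) (v w : M) :
    Submodule.span R⟦X⟧ {(PowerSeries.C (h 0 0) : R⟦X⟧) • v + (PowerSeries.C (h 1 0) : R⟦X⟧) • w,
      (PowerSeries.C (h 0 1) : R⟦X⟧) • v + (PowerSeries.C (h 1 1) : R⟦X⟧) • w} =
    Submodule.span R⟦X⟧ {v, w} := by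
  have hmul : h.1 * h⁻¹.1 = 1 := Units.mul_inv h
  have e : ∀ i j, PowerSeries.C (h i 0) * PowerSeries.C (h⁻¹ 0 j) +
      PowerSeries.C (h i 1) * PowerSeries.C (h⁻¹ 1 j) =
      (PowerSeries.C ((1 : Matrix (Fin 2) (Fin 2) R) i j) : R⟦X⟧) := by
    intro i j
    rw [← hmul, Matrix.mul_apply, Fin.sum_univ_two, map_add, map_mul, map_mul]
  have e00 := e 0 0
  have e01 := e 0 1
  have e10 := e 1 0
  have e11 := e 1 1
  simp only [Matrix.one_apply_eq, ne_eq, zero_ne_one, one_ne_zero, not_false_eq_true,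
    Matrix.one_apply_ne, map_one, map_zero] at e00 e01 e10 e11
  apply le_antisymm
  · rw [Submodule.span_le, Set.pair_subset_iff, SetLike.mem_coe, SetLike.mem_coe,
      Submodule.mem_span_pair, Submodule.mem_span_pair]
    exact ⟨⟨_, _, rfl⟩, _, _, rfl⟩
  · rw [Submodule.span_le, Set.pair_subset_iff, SetLike.mem_coe, SetLike.mem_coe,
      Submodule.mem_span_pair, Submodule.mem_span_pair]
    refine ⟨⟨PowerSeries.C (h⁻¹ 0 0), PowerSeries.C (h⁻¹ 1 0), ?_⟩,
      PowerSeries.C (h⁻¹ 0 1), PowerSeries.C (h⁻¹ 1 1), ?_⟩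
    · simp only [smul_add, smul_smul]
      rw [add_add_add_comm, ← add_smul, ← add_smul]
      simp only [mul_comm (PowerSeries.C (h⁻¹ _ _))]
      rw [e00, e10, one_smul, zero_smul, add_zero]
    · simp only [smul_add, smul_smul]
      rw [add_add_add_comm, ← add_smul, ← add_smul]
      simp only [mul_comm (PowerSeries.C (h⁻¹ _ _))]
      rw [e01, e11, one_smul, zero_smul, zero_add]

/-- The products `∏_{i < m} h_i diag(u, 1)`. -/
def chainMatrix (h : ℕ → GL (Fin 2) R) : ℕ → GL (Fin 2) R⸨X⸩
  | 0 => 1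
  | m + 1 => chainMatrix h m * stepMatrix (h m)

theorem map_chainMatrix (f : R →+* S) (h : ℕ → GL (Fin 2) R) (m : ℕ) :
    Matrix.GeneralLinearGroup.map (laurentMap f) (chainMatrix h m) =
      chainMatrix (fun i => Matrix.GeneralLinearGroup.map f (h i)) m := by
  induction m with
  | zero => exact map_one _
  | succ m ih => rw [chainMatrix, map_mul, ih, map_stepMatrix, chainMatrix]

theorem chainMatrix_congr {h h' : ℕ → GL (Fin 2) R} {m : ℕ} (H : ∀ i < m, h i = h' i) :
    chainMatrix h m = chainMatrix h' m := by
  induction m with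
  | zero => rfl
  | succ m ih =>
    rw [chainMatrix, chainMatrix, ih fun i hi => H i (hi.trans (Nat.lt_succ_self m)),
      H m (Nat.lt_succ_self m)]

/-- The chain of lattices defined by the matrices `chainMatrix h m`. -/
def LatticeChain.ofMatrix (e : ℕ) (h : ℕ → GL (Fin 2) R) : LatticeChain 2 e R where
  lattice i := LaurentLattice.ofMatrix (chainMatrix h i)
  lattice_zero := LaurentLattice.ofMatrix_one

theorem coeffVanish_X_smul {n : ℕ} {m : ℤ} {N : Submodule R⟦X⟧ (Fin n → R⸨X⸩)}
    (h : ∀ v ∈ N, ∀ i, ∀ j < m, (((PowerSeries.X : R⟦X⟧) • v) i).coeff j = 0) :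
    CoeffVanish (m - 1) N := by
  intro v hv i j hj
  have := h v hv i (j + 1) (by omega)
  rwa [Pi.smul_apply, X_smul_coeff, add_sub_cancel_right] at this

/-- In the basis `x`, `y` of columns of `g h`, the modification is spanned by `u x` and `y`. -/
theorem ofMatrix_mul_stepMatrix_le (g : GL (Fin 2) R⸨X⸩) (h : GL (Fin 2) R) :
    (LaurentLattice.ofMatrix (g * stepMatrix h)).carrier ≤
      (LaurentLattice.ofMatrix g).carrier := by
  rw [LaurentLattice.ofMatrix_carrier_two, LaurentLattice.ofMatrix_carrier_two,
    mul_stepMatrix_col_zero, mul_stepMatrix_col_one,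
    ← span_pair_GL h (g.1.transpose 0) (g.1.transpose 1), Submodule.span_le, Set.pair_subset_iff]
  exact ⟨Submodule.smul_mem _ _ (Submodule.subset_span (by simp)),
    Submodule.subset_span (by simp)⟩

theorem smul_mem_span_smul_pair {A M : Type*} [CommRing A] [AddCommGroup M] [Module A M]
    (π p q : A) (x y : M) : π • (p • x + q • y) ∈ Submodule.span A {π • x, y} :=
  Submodule.mem_span_pair.2 ⟨p, π * q, by module⟩

/-- The modification contains `u` times the original lattice, so at most one order of vanishing is
gained. -/
theorem CoeffVanish.of_mul_stepMatrix {m : ℤ} {g : GL (Fin 2) R⸨X⸩} {h : GL (Fin 2) R}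
    (H : CoeffVanish m (LaurentLattice.ofMatrix (g * stepMatrix h)).carrier) :
    CoeffVanish (m - 1) (LaurentLattice.ofMatrix g).carrier := by
  refine coeffVanish_X_smul fun v hv => H _ ?_
  rw [LaurentLattice.ofMatrix_carrier_two, ← span_pair_GL h, Submodule.mem_span_pair] at hv
  obtain ⟨p, q, rfl⟩ := hv
  rw [LaurentLattice.ofMatrix_carrier_two, mul_stepMatrix_col_zero, mul_stepMatrix_col_one]
  exact smul_mem_span_smul_pair _ p q _ _

end MatrixLattice

/-! ### Modifications of type `(1,0)` over a field as constant matrices -/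

section MatrixLatticeField

variable {K : Type*} [Field K]

/-- Two distinct modifications of a lattice span it. -/
theorem coeffVanish_of_two_modifications {m : ℤ} {g : GL (Fin 2) K⸨X⸩} {h : GL (Fin 2) K} {t : K}
    (ht : t ≠ 0)
    (H : CoeffVanish m (LaurentLattice.ofMatrix (g * stepMatrix h)).carrier)
    (H' : CoeffVanish m (LaurentLattice.ofMatrix
      (g * stepMatrix (h * Matrix.GeneralLinearGroup.upperRightHom t))).carrier) :
    CoeffVanish m (LaurentLattice.ofMatrix g).carrier := by
  rw [LaurentLattice.ofMatrix_carrier_two, ← span_pair_GL h, coeffVanish_span]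
  rw [LaurentLattice.ofMatrix_carrier_two, coeffVanish_span] at H H'
  have H1 := H _ (Set.mem_insert_of_mem _ rfl)
  have H2 := H' _ (Set.mem_insert_of_mem _ rfl)
  rw [mul_stepMatrix_col_one] at H1 H2
  -- With `x`, `y` the columns of `g h`, the two modifications contain `y` and `t x + y`. Their
  -- difference `t x` gives the condition on `x`, since `t` is invertible.
  have hU : (PowerSeries.C ((h * Matrix.GeneralLinearGroup.upperRightHom t) 0 1) : K⟦X⟧) •
      g.1.transpose 0 + (PowerSeries.C ((h * Matrix.GeneralLinearGroup.upperRightHom t) 1 1) :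
        K⟦X⟧) • g.1.transpose 1 =
      (PowerSeries.C t : K⟦X⟧) • ((PowerSeries.C (h 0 0) : K⟦X⟧) • g.1.transpose 0 +
        (PowerSeries.C (h 1 0) : K⟦X⟧) • g.1.transpose 1) +
      ((PowerSeries.C (h 0 1) : K⟦X⟧) • g.1.transpose 0 +
        (PowerSeries.C (h 1 1) : K⟦X⟧) • g.1.transpose 1) := by
    simp only [Units.val_mul, Matrix.mul_apply, Fin.sum_univ_two,
      Matrix.GeneralLinearGroup.upperRightHom_apply, Matrix.of_apply, Matrix.cons_val_zero,
      Matrix.cons_val_one, Matrix.cons_val_fin_one, mul_one, map_add, map_mul, add_smul,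
      smul_add, smul_smul, mul_comm (PowerSeries.C t)]
    abel
  rintro v (rfl | rfl)
  · intro i j hj
    have h1 := H1 i j hj
    have h2 := H2 i j hj
    set x := (PowerSeries.C (h 0 0) : K⟦X⟧) • g.1.transpose 0 +
      (PowerSeries.C (h 1 0) : K⟦X⟧) • g.1.transpose 1
    set y := (PowerSeries.C (h 0 1) : K⟦X⟧) • g.1.transpose 0 +
      (PowerSeries.C (h 1 1) : K⟦X⟧) • g.1.transpose 1
    rw [hU] at h2
    rw [Pi.add_apply, HahnSeries.coeff_add, h1, add_zero, ← single_zero_smul, Pi.smul_apply,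
      smul_eq_mul, HahnSeries.coeff_single_mul, sub_zero] at h2
    exact (mul_eq_zero.1 h2).resolve_left ht
  · exact H1

theorem LaurentLattice.ofMatrix_mul_stepMatrix_hasRelPos {μ : DominantCocharacter 2}
    (hμ : μ.toFun = ![1, 0]) (g : GL (Fin 2) K⸨X⸩) (h : GL (Fin 2) K) :
    (ofMatrix (g * stepMatrix h)).HasRelPos (ofMatrix g) μ := by
  refine hasRelPos_two_iff.2 ⟨_, _, (ofMatrix_carrier_two g).trans (span_pair_GL h _ _).symm, ?_⟩
  rw [ofMatrix_carrier_two, mul_stepMatrix_col_zero, mul_stepMatrix_col_one]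
  have h1 : (HahnSeries.single (0 : ℤ) (1 : K) : K⸨X⸩) = 1 := rfl
  rw [hμ, Matrix.cons_val_zero, Matrix.cons_val_one, Matrix.cons_val_zero, single_one_smul, h1,
    one_smul]

/-- The two cases of `exists_modification` are realized by the unipotent matrix with entry `z` and
by the permutation matrix. -/
theorem LaurentLattice.HasRelPos.exists_stepMatrix {μ : DominantCocharacter 2}
    (hμ : μ.toFun = ![1, 0]) {L' : LaurentLattice 2 K} {g : GL (Fin 2) K⸨X⸩}
    (H : L'.HasRelPos (ofMatrix g) μ) :
    ∃ h : GL (Fin 2) K, L' = ofMatrix (g * stepMatrix h) := by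
  rcases H.exists_modification hμ (ofMatrix_carrier_two g) with ⟨z, hL⟩ | hL
  · refine ⟨Matrix.GeneralLinearGroup.upperRightHom z, LaurentLattice.ext ?_⟩
    rw [ofMatrix_carrier_two, mul_stepMatrix_col_zero, mul_stepMatrix_col_one, hL]
    simp [add_comm]
  · refine ⟨⟨!![0, 1; 1, 0], !![0, 1; 1, 0], by simp [Matrix.one_fin_two],
      by simp [Matrix.one_fin_two]⟩, LaurentLattice.ext ?_⟩
    rw [ofMatrix_carrier_two, mul_stepMatrix_col_zero, mul_stepMatrix_col_one, hL]
    simp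

theorem LatticeChain.exists_eq_ofMatrix {e : ℕ} {μ : Fin e → DominantCocharacter 2}
    (hμ : ∀ i, (μ i).toFun = ![1, 0]) (c : LatticeChain 2 e K)
    (hc : ∀ i : Fin e, (c.lattice i.succ).HasRelPos (c.lattice i.castSucc) (μ i)) :
    ∃ h : ℕ → GL (Fin 2) K, c = LatticeChain.ofMatrix e h := by
  have key : ∀ m : Fin (e + 1), ∃ h : ℕ → GL (Fin 2) K, ∀ i ≤ m,
      c.lattice i = LaurentLattice.ofMatrix (chainMatrix h i) := by
    intro m
    induction m using Fin.induction with
    | zero =>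
      refine ⟨fun _ => 1, fun i hi => ?_⟩
      obtain rfl : i = 0 := Fin.le_zero_iff.1 hi
      exact c.lattice_zero.trans LaurentLattice.ofMatrix_one.symm
    | succ m ih =>
      obtain ⟨h, hh⟩ := ih
      have H := hc m
      rw [hh _ le_rfl] at H
      obtain ⟨x, hx⟩ := H.exists_stepMatrix (hμ m)
      -- The lattices of index at most `m` involve only the matrices `h j` with `j < m`, so they are
      -- unaffected.
      refine ⟨Function.update h m x, fun i hi => ?_⟩
      rcases hi.lt_or_eq with hlt | rfl
      · have hle : (i : ℕ) ≤ m := Nat.lt_succ_iff.1 hlt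
        rw [hh i hle]
        congr 1
        exact chainMatrix_congr fun j hj => (Function.update_of_ne (hj.trans_le hle).ne _ _).symm
      · rw [hx]
        congr 1
        rw [Fin.val_succ, chainMatrix, Function.update_self]
        congr 1
        exact chainMatrix_congr fun j hj => (Function.update_of_ne hj.ne _ _).symm
  obtain ⟨h, hh⟩ := key (Fin.last e)
  exact ⟨h, LatticeChain.ext (funext fun i => hh i (Fin.le_last i))⟩

end MatrixLatticeField

/-! ### Deformations of chains over `K[t]` -/

section Deformation

variable {K F : Type*} [Field K] [Field F]

/-- The sequence of matrices `h_i (1, ε_i t; 0, 1)`, over an extension of rings `ψ`. -/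
def deformMatrix {K R : Type*} [CommRing K] [CommRing R] (ψ : K →+* R) (t : R)
    (h : ℕ → GL (Fin 2) K) (ε : ℕ → K) (i : ℕ) : GL (Fin 2) R :=
  Matrix.GeneralLinearGroup.map ψ (h i) *
    Matrix.GeneralLinearGroup.upperRightHom (ψ (ε i) * t)

theorem map_deformMatrix {K R S : Type*} [CommRing K] [CommRing R] [CommRing S] (ψ : K →+* R)
    (φ : R →+* S) (t : R) (h : ℕ → GL (Fin 2) K) (ε : ℕ → K) :
    (fun i => Matrix.GeneralLinearGroup.map φ (deformMatrix ψ t h ε i)) =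
      deformMatrix (φ.comp ψ) (φ t) h ε := by
  funext i
  rw [deformMatrix, map_mul, deformMatrix]
  congr 1
  refine Units.ext (Matrix.ext fun i j => ?_)
  fin_cases i <;> fin_cases j <;> simp [Matrix.GeneralLinearGroup.upperRightHom_apply]

/-- Applies to the trivial deformation `ε = 0` and to the special fibre `t = 0`. -/
theorem deformMatrix_of_mul_eq_zero {K R : Type*} [CommRing K] [CommRing R] (ψ : K →+* R) {t : R}
    (h : ℕ → GL (Fin 2) K) {ε : ℕ → K} (H : ∀ i, ψ (ε i) * t = 0) :
    deformMatrix ψ t h ε = fun i => Matrix.GeneralLinearGroup.map ψ (h i) := by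
  funext i
  rw [deformMatrix, H, AddChar.map_zero_eq_one, mul_one]

theorem LaurentLattice.map_ofMatrix_chainMatrix {R S : Type*} [CommRing R] [CommRing S]
    (f : R →+* S) (h : ℕ → GL (Fin 2) R) (m : ℕ) :
    (ofMatrix (chainMatrix h m)).map f =
      ofMatrix (chainMatrix (fun i => Matrix.GeneralLinearGroup.map f (h i)) m) := by
  rw [map_ofMatrix, map_chainMatrix]

/-- One of `z = 0` and `z = 1` works, as the two modifications span the lattice of `g`. Taking `z`
in `K` rather than in `F` lets the deformation be defined over `K[t]`. -/
theorem exists_not_coeffVanish_mul_stepMatrix (ψ : K →+* F) {t : F} (ht : t ≠ 0) {b : ℤ}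
    {g : GL (Fin 2) F⸨X⸩} (hg : ¬ CoeffVanish b (LaurentLattice.ofMatrix g).carrier)
    (x : GL (Fin 2) F) :
    ∃ z : K, ¬ CoeffVanish b (LaurentLattice.ofMatrix (g * stepMatrix
      (x * Matrix.GeneralLinearGroup.upperRightHom (ψ z * t)))).carrier := by
  by_cases h : CoeffVanish b (LaurentLattice.ofMatrix (g * stepMatrix x)).carrier
  · refine ⟨1, fun h' => hg ?_⟩
    rw [map_one, one_mul] at h'
    exact coeffVanish_of_two_modifications ht h h'
  · refine ⟨0, ?_⟩
    rwa [map_zero, zero_mul, AddChar.map_zero_eq_one, mul_one]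

theorem chainMatrix_deformMatrix_update (ψ : K →+* F) (t : F) (h : ℕ → GL (Fin 2) K)
    (ε : ℕ → K) (m : ℕ) (z : K) :
    chainMatrix (deformMatrix ψ t h (Function.update ε m z)) (m + 1) =
      chainMatrix (deformMatrix ψ t h ε) m * stepMatrix (Matrix.GeneralLinearGroup.map ψ (h m) *
        Matrix.GeneralLinearGroup.upperRightHom (ψ z * t)) := by
  have h1 : chainMatrix (deformMatrix ψ t h (Function.update ε m z)) m =
      chainMatrix (deformMatrix ψ t h ε) m :=
    chainMatrix_congr fun i hi => by
      rw [deformMatrix, deformMatrix, Function.update_of_ne hi.ne]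
  have h2 : deformMatrix ψ t h (Function.update ε m z) m =
      Matrix.GeneralLinearGroup.map ψ (h m) *
        Matrix.GeneralLinearGroup.upperRightHom (ψ z * t) := by
    rw [deformMatrix, Function.update_self]
  rw [chainMatrix, h1, h2]

theorem not_coeffVanish_one_std : ¬ CoeffVanish 1 (LaurentLattice.std 2 K).carrier := by
  intro h
  have hmem : Pi.single 0 1 ∈ (LaurentLattice.std 2 K).carrier := Submodule.subset_span ⟨0, rfl⟩
  have h1 := h _ hmem 0 0 one_pos
  rw [Pi.single_eq_same, HahnSeries.coeff_one, if_pos rfl] at h1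
  exact one_ne_zero h1

/-- Induction on the length: `ε = 0` suffices if `b` is already optimal. Otherwise the shorter chain
is deformed first, and the last parameter is then chosen to leave `u^{b+1} Λ₀`. -/
theorem exists_deformMatrix_coeffVanish (ψ : K →+* F) {t : F} (ht : t ≠ 0)
    (h : ℕ → GL (Fin 2) K) {b : ℤ} (hb : 0 ≤ b) (m : ℕ)
    (H : CoeffVanish b (LaurentLattice.ofMatrix (chainMatrix h m)).carrier) :
    ∃ ε : ℕ → K,
      CoeffVanish b (LaurentLattice.ofMatrix (chainMatrix (deformMatrix ψ t h ε) m)).carrier ∧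
      ¬ CoeffVanish (b + 1)
        (LaurentLattice.ofMatrix (chainMatrix (deformMatrix ψ t h ε) m)).carrier := by
  have hzero : ∀ m, CoeffVanish b (LaurentLattice.ofMatrix (chainMatrix h m)).carrier →
      ¬ CoeffVanish (b + 1) (LaurentLattice.ofMatrix (chainMatrix h m)).carrier →
      ∃ ε : ℕ → K,
      CoeffVanish b (LaurentLattice.ofMatrix (chainMatrix (deformMatrix ψ t h ε) m)).carrier ∧
      ¬ CoeffVanish (b + 1)
        (LaurentLattice.ofMatrix (chainMatrix (deformMatrix ψ t h ε) m)).carrier := by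
    intro m H H'
    refine ⟨fun _ => 0, ?_⟩
    rw [deformMatrix_of_mul_eq_zero ψ h (by simp), ← LaurentLattice.map_ofMatrix_chainMatrix,
      coeffVanish_map_iff _ ψ.injective, coeffVanish_map_iff _ ψ.injective]
    exact ⟨H, H'⟩
  induction m with
  | zero =>
    refine hzero 0 H fun H' => not_coeffVanish_one_std (K := K) ?_
    rw [← LaurentLattice.ofMatrix_one]
    exact H'.of_le (by omega)
  | succ m ih =>
    by_cases H' : CoeffVanish (b + 1) (LaurentLattice.ofMatrix (chainMatrix h (m + 1))).carrier
    -- The excess order `b + 1` at `m + 1` leaves order at least `b` at `m`, which is what the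
    -- induction needs.
    · obtain ⟨ε, hε, hε'⟩ := ih (by simpa using CoeffVanish.of_mul_stepMatrix H')
      obtain ⟨z, hz⟩ := exists_not_coeffVanish_mul_stepMatrix ψ ht hε'
        (Matrix.GeneralLinearGroup.map ψ (h m))
      refine ⟨Function.update ε m z, ?_⟩
      rw [chainMatrix_deformMatrix_update]
      exact ⟨hε.mono (ofMatrix_mul_stepMatrix_le _ _), hz⟩
    · exact hzero (m + 1) H H'

end Deformation

/-! ### Strata in terms of vanishing orders -/

section Topology

variable {k : Type u} [Field k]

theorem FunctorSpace.isClosed_iff {F : CommAlgCat.{u} k ⥤ Type u} {Z : Set (FunctorSpace F)} :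
    IsClosed Z ↔ ∀ (R : CommAlgCat.{u} k) (x : F.obj R),
      IsClosed (FunctorSpace.specMap F x ⁻¹' Z) := by
  rw [← isOpen_compl_iff]
  exact forall_congr' fun R => forall_congr' fun x => isOpen_compl_iff

theorem FunctorSpace.continuous_specMap {F : CommAlgCat.{u} k ⥤ Type u} {R : CommAlgCat.{u} k}
    (x : F.obj R) : Continuous (FunctorSpace.specMap F x) :=
  continuous_def.2 fun _ hU => hU R x

theorem FunctorSpace.map_specMap {F G : CommAlgCat.{u} k ⥤ Type u} (η : F ⟶ G)
    {R : CommAlgCat.{u} k} (x : F.obj R) (p : PrimeSpectrum R) :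
    FunctorSpace.map η (FunctorSpace.specMap F x p) = FunctorSpace.specMap G (η.app R x) p := by
  exact congrArg (fun y => FieldPoint.toSpace (F := G) ⟨p.asIdeal.ResidueField, y⟩)
    (NatTrans.naturality_apply η
      (CommAlgCat.ofHom (IsScalarTower.toAlgHom k R p.asIdeal.ResidueField)) x)

theorem FunctorSpace.continuous_map {F G : CommAlgCat.{u} k ⥤ Type u} (η : F ⟶ G) :
    Continuous (FunctorSpace.map η) := by
  refine continuous_def.2 fun U hU R x => ?_
  rw [← Set.preimage_comp]
  have : FunctorSpace.map η ∘ FunctorSpace.specMap F x = FunctorSpace.specMap G (η.app R x) :=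
    funext fun p => FunctorSpace.map_specMap η x p
  rw [this]
  exact hU R _

theorem FieldPoint.toSpace_eq_of_map {F : CommAlgCat.{u} k ⥤ Type u} {x y : FieldPoint F}
    (f : x.K →ₐ[k] y.K) (h : F.map (CommAlgCat.ofHom f) x.pt = y.pt) : x.toSpace = y.toSpace :=
  Quot.sound ⟨f, h⟩

variable (k) in
/-- The locus of the affine Grassmannian of lattices contained in `u^m R[[u]]^n`. -/
def vanishingLocus (n : ℕ) (m : ℤ) : Set (FunctorSpace (affineGr k n)) :=
  {p | Quot.liftOn p (fun y => CoeffVanish m (LaurentLattice.carrier (R := y.K) y.pt)) <| by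
    rintro x y ⟨f, hf⟩
    rw [← hf]
    exact propext (coeffVanish_map_iff f.toRingHom f.toRingHom.injective _).symm}

theorem toSpace_mem_vanishingLocus {n : ℕ} {m : ℤ} {K : Type u} [Field K] [Algebra k K]
    (L : LaurentLattice n K) :
    FieldPoint.toSpace (F := affineGr k n) ⟨K, L⟩ ∈ vanishingLocus k n m ↔
      CoeffVanish m L.carrier := Iff.rfl

/-- For a family over `R` the locus is the zero set of all coefficients of degree below `m` of
elements of `L`. -/
theorem isClosed_vanishingLocus (n : ℕ) (m : ℤ) : IsClosed (vanishingLocus k n m) := by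
  rw [FunctorSpace.isClosed_iff]
  intro R (L : LaurentLattice n R)
  rw [PrimeSpectrum.isClosed_iff_zeroLocus]
  refine ⟨{r | ∃ v ∈ L.carrier, ∃ i, ∃ j < m, (v i).coeff j = r}, ?_⟩
  ext p
  refine (coeffVanish_map (algebraMap R p.asIdeal.ResidueField) L).trans ?_
  simp only [Ideal.algebraMap_residueField_eq_zero]
  rw [PrimeSpectrum.mem_zeroLocus]
  constructor
  · rintro h _ ⟨v, hv, i, j, hj, rfl⟩
    exact h v hv i j hj
  · exact fun h v hv i j hj => h ⟨v, hv, i, j, hj, rfl⟩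

/-- For equal sums, `a₀ ≤ b₀` amounts to `b₁ ≤ a₁`. -/
theorem DominantCocharacter.le_iff_two {a b : DominantCocharacter 2} :
    a ≤ b ↔ b.toFun 1 ≤ a.toFun 1 ∧
      a.toFun 0 + a.toFun 1 = b.toFun 0 + b.toFun 1 := by
  have h0 : Finset.Iic (0 : Fin 2) = {0} := rfl
  have h1 : Finset.Iic (1 : Fin 2) = Finset.univ := rfl
  change (∀ i, ∑ j ∈ Finset.Iic i, a.toFun j ≤ ∑ j ∈ Finset.Iic i, b.toFun j) ∧
    ∑ j, a.toFun j = ∑ j, b.toFun j ↔ _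
  rw [Fin.forall_fin_two, h0, h1, Finset.sum_singleton, Finset.sum_singleton, Fin.sum_univ_two,
    Fin.sum_univ_two]
  omega

theorem DominantCocharacter.le_total_iff {e : ℕ} {μ : Fin e → DominantCocharacter 2}
    (hμ : ∀ i, (μ i).toFun = ![1, 0]) {a : DominantCocharacter 2} :
    a ≤ total μ ↔ 0 ≤ a.toFun 1 ∧ a.toFun 0 + a.toFun 1 = e := by
  rw [le_iff_two]
  simp [total, hμ]

variable {e : ℕ} {μ : Fin e → DominantCocharacter 2} {K : Type u} [Field K] [Algebra k K]

/-- Membership in a stratum only provides a representative of the point over some other field. The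
order of vanishing does not depend on the representative and, with the sum fixed to `e`, recovers
the relative position. -/
theorem toSpace_mem_affineGrStratum_iff (hμ : ∀ i, (μ i).toFun = ![1, 0]) {c : LatticeChain 2 e K}
    (hc : ∀ i : Fin e, (c.lattice i.succ).HasRelPos (c.lattice i.castSucc) (μ i))
    {a : DominantCocharacter 2} (ha : a ≤ DominantCocharacter.total μ) :
    FieldPoint.toSpace (F := affineGr k 2) ⟨K, c.lattice (Fin.last e)⟩ ∈ affineGrStratum k 2 a ↔
      ∀ m, CoeffVanish m (c.lattice (Fin.last e)).carrier ↔ m ≤ a.toFun 1 := by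
  constructor
  · rintro ⟨K', _, _, L, hL, h⟩ m
    rw [← h.coeffVanish_iff m, ← toSpace_mem_vanishingLocus (k := k), hL]
    rfl
  · intro h
    obtain ⟨a', ha', hsum, -⟩ := c.exists_hasRelPos hμ hc (Fin.last e)
    have h1 : a'.toFun 1 = a.toFun 1 :=
      eq_of_forall_le_iff fun m => (ha'.coeffVanish_iff m).symm.trans (h m)
    have h2 := ((DominantCocharacter.le_total_iff hμ).1 ha).2
    rw [Fin.val_last] at hsum
    have : a' = a := by
      refine DominantCocharacter.ext (funext fun i => ?_)
      fin_cases i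
      · change a'.toFun 0 = a.toFun 0
        omega
      · exact h1
    subst this
    exact ⟨K, _, _, _, rfl, ha'⟩

/-! ### Specializations in the convolution locus -/

theorem LatticeChain.ofMatrix_hasRelPos (hμ : ∀ i, (μ i).toFun = ![1, 0])
    (h : ℕ → GL (Fin 2) K) (i : Fin e) :
    ((ofMatrix e h).lattice i.succ).HasRelPos ((ofMatrix e h).lattice i.castSucc) (μ i) :=
  LaurentLattice.ofMatrix_mul_stepMatrix_hasRelPos (hμ i) _ _

theorem toSpace_ofMatrix_eq_of_algHom {K' : Type u} [Field K'] [Algebra k K']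
    (h : ℕ → GL (Fin 2) K) (f : K →ₐ[k] K') :
    FieldPoint.toSpace (F := convolutionGr k 2 e) ⟨K, LatticeChain.ofMatrix e h⟩ =
      FieldPoint.toSpace (F := convolutionGr k 2 e) ⟨K', LatticeChain.ofMatrix e
        fun i => Matrix.GeneralLinearGroup.map (f : K →+* K') (h i)⟩ :=
  FieldPoint.toSpace_eq_of_map (F := convolutionGr k 2 e) f
    (LatticeChain.ext (funext fun _ => LaurentLattice.map_ofMatrix_chainMatrix _ _ _))

theorem continuous_specMap_ofMatrix {R : Type u} [CommRing R] [Algebra k R]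
    (h : ℕ → GL (Fin 2) R) :
    Continuous fun p : PrimeSpectrum R => FieldPoint.toSpace (F := convolutionGr k 2 e)
      ⟨p.asIdeal.ResidueField, LatticeChain.ofMatrix e fun i =>
        Matrix.GeneralLinearGroup.map (algebraMap R p.asIdeal.ResidueField) (h i)⟩ := by
  refine (FunctorSpace.continuous_specMap (F := convolutionGr k 2 e) (R := CommAlgCat.of k R)
    (LatticeChain.ofMatrix e h : LatticeChain 2 e R)).congr fun p => ?_
  exact congrArg (fun y : LatticeChain 2 e p.asIdeal.ResidueField =>
    FieldPoint.toSpace (F := convolutionGr k 2 e) ⟨p.asIdeal.ResidueField, y⟩)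
    (LatticeChain.ext (funext fun _ => LaurentLattice.map_ofMatrix_chainMatrix _ _ _))

open Polynomial in
/-- A point of the convolution locus whose last lattice lies in `u^b K[[u]]^2` is a specialization
of such points for which `b` is optimal. -/
theorem exists_specializes_coeffVanish (hμ : ∀ i, (μ i).toFun = ![1, 0]) {c : LatticeChain 2 e K}
    (hc : ∀ i : Fin e, (c.lattice i.succ).HasRelPos (c.lattice i.castSucc) (μ i))
    {b : ℤ} (hb : 0 ≤ b) (H : CoeffVanish b (c.lattice (Fin.last e)).carrier) :
    ∃ (F : Type u) (_ : Field F) (_ : Algebra k F) (d : LatticeChain 2 e F),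
      (∀ i : Fin e, (d.lattice i.succ).HasRelPos (d.lattice i.castSucc) (μ i)) ∧
      CoeffVanish b (d.lattice (Fin.last e)).carrier ∧
      ¬ CoeffVanish (b + 1) (d.lattice (Fin.last e)).carrier ∧
      FieldPoint.toSpace (F := convolutionGr k 2 e) ⟨F, d⟩ ⤳
        FieldPoint.toSpace (F := convolutionGr k 2 e) ⟨K, c⟩ := by
  obtain ⟨h, rfl⟩ := c.exists_eq_ofMatrix hμ hc
  -- `η` is the generic point of the affine line over `K`, and `s` is a point where `t = 0`.
  obtain ⟨η, hηbot⟩ : ∃ η : PrimeSpectrum K[X], η.asIdeal = ⊥ := ⟨⟨⊥, Ideal.isPrime_bot⟩, rfl⟩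
  obtain ⟨s, hX⟩ : ∃ s : PrimeSpectrum K[X], X ∈ s.asIdeal :=
    ⟨⟨Ideal.span {X}, (Ideal.span_singleton_prime X_ne_zero).2 prime_X⟩,
      Ideal.mem_span_singleton_self X⟩
  have hη : algebraMap K[X] η.asIdeal.ResidueField X ≠ 0 := fun h =>
    X_ne_zero (Ideal.mem_bot.1 (hηbot ▸ Ideal.algebraMap_residueField_eq_zero.1 h))
  have hs : algebraMap K[X] s.asIdeal.ResidueField X = 0 :=
    Ideal.algebraMap_residueField_eq_zero.2 hX
  obtain ⟨ε, h1, h2⟩ := exists_deformMatrix_coeffVanish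
    ((algebraMap K[X] η.asIdeal.ResidueField).comp C) hη h hb e H
  refine ⟨η.asIdeal.ResidueField, inferInstance, inferInstance, LatticeChain.ofMatrix e
    (deformMatrix ((algebraMap K[X] η.asIdeal.ResidueField).comp C)
      (algebraMap K[X] η.asIdeal.ResidueField X) h ε),
    LatticeChain.ofMatrix_hasRelPos hμ _, h1, h2, ?_⟩
  have hspec : η ⤳ s := (PrimeSpectrum.le_iff_specializes η s).1
    (show η.asIdeal ≤ s.asIdeal from hηbot ▸ bot_le)
  -- The family over `K[t]` defines a continuous map from the line, which carries the specialization
  -- of `η` to `s` into the convolution product.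
  have hmap := hspec.map (continuous_specMap_ofMatrix (k := k) (e := e) (deformMatrix C X h ε))
  rw [map_deformMatrix, map_deformMatrix, hs,
    deformMatrix_of_mul_eq_zero ((algebraMap K[X] s.asIdeal.ResidueField).comp C) h
      fun i => mul_zero _] at hmap
  -- The fibre at `s` is the base change of the given chain to the residue field of `s`, so it
  -- represents the same point.
  rw [toSpace_ofMatrix_eq_of_algHom h ((IsScalarTower.toAlgHom k K[X] s.asIdeal.ResidueField).comp
    (IsScalarTower.toAlgHom k K K[X]))]
  exact hmap

end Topology

end

/-- Here `X_a` is the inverse image of `Gr_a` under the convolution morphism, restricted to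
`Gr_{(1,0)} ×~ ... ×~ Gr_{(1,0)}`. -/
theorem proposition3p16 (k : Type u) [Field k] (e : ℕ) (μ : Fin e → DominantCocharacter 2)
    (hμ : ∀ i, (μ i).toFun = ![1, 0]) :
    IsGoodStratification
      (fun a : {a : DominantCocharacter 2 // a ≤ DominantCocharacter.total μ} =>
        {x : convolutionStratum k 2 e μ |
          FunctorSpace.map (convolutionMorphism k 2 e) x.1 ∈ affineGrStratum k 2 a.1}) := by
  have hclosure : ∀ a : {a : DominantCocharacter 2 // a ≤ DominantCocharacter.total μ},
      closure {x : convolutionStratum k 2 e μ |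
        FunctorSpace.map (convolutionMorphism k 2 e) x.1 ∈ affineGrStratum k 2 a.1} =
      ⋃ j ≤ a, {x : convolutionStratum k 2 e μ |
        FunctorSpace.map (convolutionMorphism k 2 e) x.1 ∈ affineGrStratum k 2 j.1} := by
    rintro ⟨a, ha⟩
    have ha' := (DominantCocharacter.le_total_iff hμ).1 ha
    apply Set.Subset.antisymm
    -- The closed condition `Λ_e ⊆ u^{a₁} Λ₀` contains `X_a` and, inside the convolution locus, only
    -- meets strata with second entry at least `a₁`.
    · have hZ : IsClosed {x : convolutionStratum k 2 e μ |
          FunctorSpace.map (convolutionMorphism k 2 e) x.1 ∈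
            vanishingLocus k 2 (a.toFun 1)} :=
        (isClosed_vanishingLocus 2 _).preimage
          ((FunctorSpace.continuous_map _).comp continuous_subtype_val)
      refine (closure_minimal ?_ hZ).trans ?_
      · rintro ⟨_, K, _, _, c, rfl, hc⟩ hx
        exact ((toSpace_mem_affineGrStratum_iff hμ hc ha).1 hx _).2 le_rfl
      · rintro ⟨_, K, _, _, c, rfl, hc⟩ hx
        obtain ⟨b, hb, hsum, hnonneg⟩ := c.exists_hasRelPos hμ hc (Fin.last e)
        rw [Fin.val_last] at hsum
        rw [Set.mem_iUnion₂]
        refine ⟨⟨b, (DominantCocharacter.le_total_iff hμ).2 ⟨hnonneg, hsum⟩⟩,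
          DominantCocharacter.le_iff_two.2 ⟨(hb.coeffVanish_iff _).1 hx, hsum.trans ha'.2.symm⟩,
          K, _, _, _, rfl, hb⟩
    · refine Set.iUnion₂_subset ?_
      rintro ⟨b, hb⟩ hba ⟨_, K, _, _, c, rfl, hc⟩ hx
      have hle := (DominantCocharacter.le_iff_two.1 hba).1
      obtain ⟨F, _, _, d, hd, h1, h2, hspec⟩ := exists_specializes_coeffVanish (k := k) hμ hc ha'.1
        (((toSpace_mem_affineGrStratum_iff hμ hc hb).1 hx _).2 hle)
      let y : convolutionStratum k 2 e μ :=
        ⟨FieldPoint.toSpace (F := convolutionGr k 2 e) ⟨F, d⟩, F, _, _, d, rfl, hd⟩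
      -- The generization `y` lies in the convolution locus, so the specialization takes place in
      -- the subspace topology; it remains to see that `y` is in `X_a`.
      refine (Topology.IsInducing.subtypeVal.specializes_iff (x := y).1 hspec).mem_closed
        isClosed_closure (subset_closure ?_)
      refine (toSpace_mem_affineGrStratum_iff hμ hd ha).2 fun m => ⟨fun hm => ?_, fun hm => ?_⟩
      · by_contra! hlt
        exact h2 (hm.of_le (by omega))
      · exact h1.of_le hm
  refine ⟨⟨?_, ?_, fun a => (hclosure a).subset⟩, hclosure⟩
  · rw [Set.eq_univ_iff_forall]
    rintro ⟨_, K, _, _, c, rfl, hc⟩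
    obtain ⟨b, hb, hsum, hnonneg⟩ := c.exists_hasRelPos hμ hc (Fin.last e)
    rw [Fin.val_last] at hsum
    exact Set.mem_iUnion.2 ⟨⟨b, (DominantCocharacter.le_total_iff hμ).2 ⟨hnonneg, hsum⟩⟩,
      K, _, _, _, rfl, hb⟩
  · rintro ⟨a, ha⟩ ⟨b, hb⟩ hab
    rw [Set.disjoint_left]
    rintro ⟨_, K, _, _, c, rfl, hc⟩ hxa hxb
    apply hab
    have h1 := (toSpace_mem_affineGrStratum_iff hμ hc ha).1 hxa
    have h2 := (toSpace_mem_affineGrStratum_iff hμ hc hb).1 hxb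
    -- Both second entries are the largest `m` with `Λ_e ⊆ u^m Λ₀`.
    have h3 : a.toFun 1 = b.toFun 1 := eq_of_forall_le_iff fun m => (h1 m).symm.trans (h2 m)
    have ha' := (DominantCocharacter.le_total_iff hμ).1 ha
    have hb' := (DominantCocharacter.le_total_iff hμ).1 hb
    refine Subtype.ext (le_antisymm ?_ ?_)
    · exact DominantCocharacter.le_iff_two.2 ⟨h3.ge, ha'.2.trans hb'.2.symm⟩
    · exact DominantCocharacter.le_iff_two.2 ⟨h3.le, hb'.2.trans ha'.2.symm⟩
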